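/- Let $K$ be an algebraically closed field of characteristic $0$, let $V$ be a $K$-vector space of dimension $n+1$, and let $0\le k\le n+1$ and $s\ge 1$ be integers. Let $\nu_k(G_{k,n+1})\subset \mathbb P(\wedge^k V)$ be the Grassmannian of $k$-dimensional subspaces of $V$ in its Plücker embedding, i.e. the set of points $[v_1\wedge\dots\wedge v_k]$ with $v_1,\dots,v_k\in V$ linearly independent. Let $[\nu_k(G_{k,n+1})]^s$ be its $s$-th secant variety, i.e. the Zariski closure of the union of all linear subspaces of $\mathbb P(\wedge^kV)$ spanned by $s$ (not necessarily distinct) points of $\nu_k(G_{k,n+1})$. Let $\mathcal B_j=\{v_{1,j},\dots,v_{k,j}\}$, $j=1,\dots,s$, be $s$ sets of $k$ generic vectors in $V$ (that is, the tuple $(v_{i,j})$ lies in a suitable nonempty Zariski open subset of $V^{ks}$), let $I_j=(v_{1,j},\dots,v_{k,j})\subset\bigwedge(V)$ be the ideal of the exterior algebra which they generate, and let $$W=(I_1^2\cap\dots\cap I_s^2)_{n+1-k}\subseteq\wedge^{n+1-k}V$$ be the degree $n+1-k$ part of the intersection of the squares of these ideals. Put $W^\perp=\{w\in\wedge^kV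 \mid y\wedge w=0\text{ for all }y\in W\}$. Then $$\dim\,[\nu_k(G_{k,n+1})]^s=\dim_KW^\perp-1=\left[\binom{n+1}{k}-\dim_KW\right]-1=\left[\binom{n+1}{k}-1\right]-\dim_KW .$$ -/

import Mathlib

open scoped LinearAlgebra.Projectivization ExteriorAlgebra

noncomputable section

namespace GrassmannSecant

section General

variable (K : Type*) [Field K] (E : Type*) [AddCommGroup E] [Module K E] [FiniteDimensional K E]

/-- The value at `x : E` of a polynomial in the coordinates of `E` (with respect to a fixed basis;
being a polynomial function, resp. a homogeneous one of degree `d`, does not depend on the basis). -/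
def evalAt (f : MvPolynomial (Fin (Module.finrank K E)) K) (x : E) : K :=
  MvPolynomial.eval (fun i => (Module.finBasis K E).repr x i) f

/-- `p` holds for generic `x : E`: it holds on the complement of the zero set of some nonzero
polynomial function. Over an infinite field this says that `p` holds on a nonempty (hence dense)
Zariski open subset of `E`. -/
def Generically (p : E → Prop) : Prop :=
  ∃ f : MvPolynomial (Fin (Module.finrank K E)) K, f ≠ 0 ∧ ∀ x : E, evalAt K E f x ≠ 0 → p x

/-- The Zariski topology on the projective space `ℙ(E)`: it is generated by the sets `{f ≠ 0}`
for homogeneous polynomials `f`. Nonvanishing of a homogeneous polynomial does not depend on the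
representative of a point, and these sets are closed under finite intersections, so the closed
sets are exactly the common zero sets of families of homogeneous polynomials. -/
@[reducible]
def zariskiTopology : TopologicalSpace (ℙ K E) :=
  TopologicalSpace.generateFrom
    {U | ∃ (d : ℕ) (f : MvPolynomial (Fin (Module.finrank K E)) K),
      f.IsHomogeneous d ∧ U = {P : ℙ K E | evalAt K E f P.rep ≠ 0}}

/-- The dimension of a subset of projective space: the Krull dimension of the subspace topology
induced by the Zariski topology, i.e. the supremum of the lengths of chains of irreducible closed
subsets. -/
def dim (X : Set (ℙ K E)) : WithBot ℕ∞ :=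
  letI : TopologicalSpace (ℙ K E) := zariskiTopology K E
  topologicalKrullDim X

/-- The `s`-th (higher) secant variety of `X ⊆ ℙ(E)`: the Zariski closure of the union of all the
projective linear subspaces spanned by `s` points of `X`. -/
def secantVariety (X : Set (ℙ K E)) (s : ℕ) : Set (ℙ K E) :=
  letI : TopologicalSpace (ℙ K E) := zariskiTopology K E
  closure {Q : ℙ K E | ∃ P : Fin s → ℙ K E,
    (∀ i, P i ∈ X) ∧ Q.submodule ≤ ⨆ i, (P i).submodule}

end General

section Exterior

variable (K : Type*) [Field K] (V : Type*) [AddCommGroup V] [Module K V]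

/-- The Grassmannian of `k`-dimensional subspaces of `V` in its Plücker embedding into `ℙ(⋀ᵏ V)`:
the subspace with basis `v₁, …, v_k` is sent to the point `[v₁ ∧ ⋯ ∧ v_k]`. -/
def pluckerGrassmannian (k : ℕ) : Set (ℙ K (⋀[K]^k V)) :=
  {P | ∃ v : Fin k → V, LinearIndependent K v ∧
    P.submodule = Submodule.span K {exteriorPower.ιMulti K k v}}

variable {V}

/-- The (two-sided) ideal of the exterior algebra generated by the vectors `v₁, …, v_k`. -/
def idealOf {k : ℕ} (v : Fin k → V) : Ideal (ExteriorAlgebra K V) :=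
  (TwoSidedIdeal.span (Set.range fun i => ExteriorAlgebra.ι K (v i))).asIdeal

/-- The degree `m` part of the intersection `I₁² ∩ ⋯ ∩ I_s²`, where `I_j` is the ideal
`(v_{1,j}, …, v_{k,j})`. -/
def fatPiece {s k : ℕ} (v : Fin s → Fin k → V) (m : ℕ) : Submodule K (ExteriorAlgebra K V) :=
  (⨅ j, idealOf K (v j) * idealOf K (v j) : Ideal (ExteriorAlgebra K V)).restrictScalars K ⊓ ⋀[K]^m V

/-- The perpendicular space `Y^⊥ = {w ∈ ⋀ᵐ V | y ∧ w = 0 for all y ∈ Y}`; it is used for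
`Y ⊆ ⋀^{n+1-m} V`, where `dim V = n + 1`. -/
def perp (m : ℕ) (Y : Submodule K (ExteriorAlgebra K V)) : Submodule K (ExteriorAlgebra K V) where
  carrier := {w | w ∈ ⋀[K]^m V ∧ ∀ y ∈ Y, y * w = 0}
  add_mem' := fun ha hb => ⟨add_mem ha.1 hb.1, fun y hy => by
    rw [mul_add, ha.2 y hy, hb.2 y hy, add_zero]⟩
  zero_mem' := ⟨zero_mem _, fun y _ => mul_zero y⟩
  smul_mem' := fun c _ ha => ⟨Submodule.smul_mem _ c ha.1, fun y hy => by
    rw [mul_smul_comm, ha.2 y hy, smul_zero]⟩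

end Exterior

end GrassmannSecant

end

/-!
The dimension of a secant variety is computed infinitesimally. The union of the spans of `s` points
of the Grassmannian is the projectivisation of the image of the polynomial map
`Φ(t, v) = ∑ t_j v_{1,j} ∧ ⋯ ∧ v_{k,j}`, which is homogeneous of degree `k + 1`. Two facts give the
theorem.

*Dimension is the rank of the differential minus one* (`dim_closure_imagePoints`), for the closure
of the image of any homogeneous polynomial map of positive degree in characteristic zero, where
the rank `r` is the maximal one. A chain of irreducible closed subsets gives a chain of prime
ideals, the ideals of their cones, which contain the relations between the components of `Φ`. A
chain of primes of length `m` ending in the ideal of the vertex gives `m` algebraically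
independent polynomials in the components of `Φ` (`exists_independent_of_chain`), and
algebraically independent polynomials have independent differentials at some point
(`exists_differential_surjective`), so `m ≤ r`. Conversely, the images of a flag of linear
subspaces of the parameter space, transversal to the kernel of the differential at a general
point, form a strict chain: by the other half of the Jacobian criterion
(`algebraicIndependent_of_det_ne_zero`), the transcendence degree grows at each step.

*The image of the differential is the sum of the tangent spaces* `T_j` of the cone over the
Grassmannian (Terracini's lemma, `range_differential_secantPoly`). For independent vectors
`v_{1,j}, …, v_{k,j}`, a monomial computation in an adapted basis shows that the degree
`n + 1 - k` part of `I_j²` is the orthogonal of `T_j` under the wedge product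
(`mem_idealOf_sq_iff`). This product being a perfect pairing of `⋀^{n+1-k} V` and `⋀^k V`, the
orthogonal of `W = ⋂ (I_j²)_{n+1-k}` is `∑ T_j`, and `dim W` and `dim ∑ T_j` add up to the binomial coefficient
(`finrank_fatPiece_perp`).
-/

noncomputable section

namespace GrassmannSecant

/-! ### Differentials and algebraic independence -/

section Differentials

variable {K : Type*} [Field K] {σ : Type*} {ι : Type*}

open MvPolynomial

lemma exists_eval_ne_zero [Infinite K] {f : MvPolynomial σ K} (hf : f ≠ 0) :
    ∃ x, eval x f ≠ 0 := by
  by_contra! h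
  exact hf (MvPolynomial.funext fun x => by rw [h x, map_zero])

lemma totalDegree_pderiv_le {i : σ} {p : MvPolynomial σ K} {n : ℕ} (hp : p.totalDegree ≤ n + 1) :
    (pderiv i p).totalDegree ≤ n := by
  refine Finset.sup_le fun m hm => ?_
  rw [mem_support_iff, coeff_pderiv] at hm
  have h1 : m + Finsupp.single i 1 ∈ p.support := mem_support_iff.2 (left_ne_zero_of_mul hm)
  have h2 := (le_totalDegree h1).trans hp
  have h3 : (m + Finsupp.single i 1).sum (fun _ e => e) = m.sum (fun _ e => e) + 1 := by
    rw [Finsupp.sum_add_index' (fun _ => rfl) (fun _ _ _ => rfl), Finsupp.sum_single_index rfl]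
  omega

lemma eq_C_of_pderiv_eq_zero [CharZero K] {p : MvPolynomial σ K} (hp : ∀ i, pderiv i p = 0) :
    p = C (coeff 0 p) := by
  classical
  ext m
  rw [coeff_C]
  split_ifs with h
  · rw [h]
  · obtain ⟨i, hi⟩ : ∃ i, m i ≠ 0 := by
      by_contra! H
      exact h (Finsupp.ext fun i => (H i).symm)
    have h1 := congrArg (coeff (m - Finsupp.single i 1)) (hp i)
    rw [coeff_pderiv, coeff_zero, tsub_add_cancel_of_le
      (Finsupp.single_le_iff.2 (Nat.one_le_iff_ne_zero.2 hi))] at h1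
    exact (mul_eq_zero.1 h1).resolve_right (Nat.cast_add_one_ne_zero _)

/-- The derivative of polynomials in the constant direction `w`. -/
def dirDeriv (w : σ → K) : Derivation K (MvPolynomial σ K) (MvPolynomial σ K) :=
  mkDerivation K fun i => C (w i)

/-- The chain rule, for a derivation applied to a polynomial expression. -/
lemma derivation_aeval [Fintype ι] (D : Derivation K (MvPolynomial σ K) (MvPolynomial σ K))
    (f : ι → MvPolynomial σ K) (P : MvPolynomial ι K) :
    D (aeval f P) = ∑ j, aeval f (pderiv j P) * D (f j) := by
  classical
  induction P using MvPolynomial.induction_on with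
  | C a => simp
  | add p q hp hq => simp only [map_add, hp, hq, add_mul, Finset.sum_add_distrib]
  | mul_X p i h =>
    simp only [map_mul, aeval_X, Derivation.leibniz, h, smul_eq_mul, pderiv_X, map_add, add_mul,
      Finset.sum_add_distrib]
    congr 1
    · simp [Pi.single_apply, apply_ite, ite_mul]
    · rw [Finset.mul_sum]
      exact Finset.sum_congr rfl fun j _ => by ring

/-- The Jacobian criterion, easy half: polynomials with independent differentials at one point
are algebraically independent. A relation of minimal degree would have vanishing partial
derivatives, hence be constant in characteristic zero. -/
lemma algebraicIndependent_of_det_ne_zero [CharZero K] [Fintype ι] [DecidableEq ι]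
    (f : ι → MvPolynomial σ K) (x : σ → K) (w : ι → σ → K)
    (h : (Matrix.of fun l j => eval x (dirDeriv (w l) (f j))).det ≠ 0) :
    AlgebraicIndependent K f := by
  set M : Matrix ι ι (MvPolynomial σ K) := Matrix.of fun l j => dirDeriv (w l) (f j) with hM
  have hdet : M.det ≠ 0 := by
    intro h0
    apply h
    have := RingHom.map_det (eval x) M
    rw [h0, map_zero] at this
    exact this.symm
  rw [algebraicIndependent_iff]
  -- Induction on the degree of a relation `P`: differentiating it in the directions `w l` shows
  -- that the partial derivatives of `P` are again relations.
  suffices ∀ n (P : MvPolynomial ι K), P.totalDegree ≤ n → aeval f P = 0 → P = 0 from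
    fun P => this _ P le_rfl
  intro n
  induction n with
  | zero =>
    intro P hP h0
    rw [totalDegree_eq_zero_iff_eq_C.1 (Nat.le_zero.1 hP)] at h0 ⊢
    rw [aeval_C, algebraMap_eq] at h0
    rw [C_injective _ _ (h0.trans (C_0).symm), C_0]
  | succ n ih =>
    intro P hP h0
    have hz : ∀ j, pderiv j P = 0 := by
      intro j
      refine ih _ (totalDegree_pderiv_le hP) ?_
      have hv : M.mulVec (fun j => aeval f (pderiv j P)) = 0 := by
        ext1 l
        have := derivation_aeval (dirDeriv (w l)) f P
        rw [h0, map_zero] at this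
        rw [Pi.zero_apply, this]
        exact Finset.sum_congr rfl fun j _ => mul_comm _ _
      exact congrFun (Matrix.eq_zero_of_mulVec_eq_zero hdet hv) j
    rw [eq_C_of_pderiv_eq_zero hz] at h0 ⊢
    rw [aeval_C, algebraMap_eq] at h0
    rw [C_injective _ _ (h0.trans (C_0).symm), C_0]

/-- Elements algebraic over a domain of characteristic zero are simple roots of some
polynomial: differentiate an annihilating polynomial as long as the element stays a root. -/
lemma exists_aeval_derivative_ne_zero {A B : Type*} [CommRing A] [IsDomain A] [CharZero A]
    [CommRing B] [Algebra A B] [FaithfulSMul A B] {a : B} (ha : IsAlgebraic A a) :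
    ∃ P : Polynomial A, Polynomial.aeval a P = 0 ∧
      Polynomial.aeval a (Polynomial.derivative P) ≠ 0 := by
  obtain ⟨P, hP, h0⟩ := ha
  induction hn : P.natDegree using Nat.strong_induction_on generalizing P with
  | _ n ih =>
    by_cases hd : Polynomial.aeval a (Polynomial.derivative P) = 0
    · have hpos : P.natDegree ≠ 0 := by
        intro h
        rw [Polynomial.eq_C_of_natDegree_eq_zero h, Polynomial.aeval_C] at h0
        have := FaithfulSMul.algebraMap_injective A B (h0.trans (map_zero _).symm)
        apply hP
        rw [Polynomial.eq_C_of_natDegree_eq_zero h, this, Polynomial.C_0]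
      refine ih _ ?_ (Polynomial.derivative P) ?_ hd rfl
      · rw [← hn]; exact Polynomial.natDegree_derivative_lt hpos
      · intro h
        exact hpos (Polynomial.derivative_eq_zero.1 h)
    · exact ⟨P, h0, hd⟩

variable [Fintype σ]

lemma dirDeriv_apply (w : σ → K) (f : MvPolynomial σ K) :
    dirDeriv w f = ∑ i, C (w i) * pderiv i f := by
  have : dirDeriv w = ∑ i, w i • (pderiv i : Derivation K (MvPolynomial σ K) _) := by
    classical
    refine derivation_ext fun j => ?_
    have h : (∑ i, w i • (pderiv i : Derivation K (MvPolynomial σ K) _)) (X j)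
        = ∑ i, w i • pderiv i (X j : MvPolynomial σ K) := by
      rw [← Derivation.coeFnAddMonoidHom_apply, map_sum, Finset.sum_apply]
      rfl
    rw [h]
    simp [dirDeriv, mkDerivation_X, pderiv_X, Pi.single_apply, smul_eq_C_mul]
  rw [this, ← Derivation.coeFnAddMonoidHom_apply, map_sum, Finset.sum_apply]
  simp [smul_eq_C_mul]

/-- The differential at `x` of the polynomial map with components `Φ j`. -/
def differential (Φ : ι → MvPolynomial σ K) (x : σ → K) : (σ → K) →ₗ[K] (ι → K) where
  toFun w j := eval x (dirDeriv w (Φ j))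
  map_add' u v := by
    ext j; simp [dirDeriv_apply, add_mul, Finset.sum_add_distrib]
  map_smul' c v := by
    ext j; simp [dirDeriv_apply, mul_assoc, Finset.mul_sum]

lemma differential_apply (Φ : ι → MvPolynomial σ K) (x w : σ → K) (j : ι) :
    differential Φ x w j = eval x (dirDeriv w (Φ j)) := rfl

/-- The Jacobian criterion, converse half: algebraically independent polynomials have independent
differentials at some point. After completing them to a transcendence basis, each variable is a
simple root of a polynomial over the algebra they generate, so that a direction killed by all
the differentials is zero wherever the relevant derivatives do not vanish. -/
lemma exists_differential_surjective [CharZero K] {m : ℕ} (f : Fin m → MvPolynomial σ K)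
    (hf : AlgebraicIndependent K f) :
    ∃ x, Function.Surjective (differential f x) := by
  classical
  obtain ⟨Z, hfZ, hZ⟩ := exists_isTranscendenceBasis_superset hf.coe_range
  obtain ⟨e⟩ := Cardinal.lift_mk_eq'.1
    (hZ.lift_cardinalMk_eq (IsTranscendenceBasis.mvPolynomial σ K))
  let _ : Fintype Z := Fintype.ofEquiv σ e.symm
  have halg := hZ.isAlgebraic
  choose P hP hP' using fun i => exists_aeval_derivative_ne_zero (halg.isAlgebraic (X i))
  obtain ⟨x, hx⟩ := exists_eval_ne_zero (Finset.prod_ne_zero_iff.2 fun i _ => hP' i)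
  rw [map_prod, Finset.prod_ne_zero_iff] at hx
  refine ⟨x, ?_⟩
  have hinj : Function.Injective (differential ((↑) : Z → MvPolynomial σ K) x) := by
    rw [injective_iff_map_eq_zero]
    intro w hw
    have hcoef : ∀ c ∈ Algebra.adjoin K (Set.range ((↑) : Z → MvPolynomial σ K)),
        eval x (dirDeriv w c) = 0 := by
      intro c hc
      induction hc using Algebra.adjoin_induction with
      | mem c hc =>
        obtain ⟨z, rfl⟩ := hc
        exact congrFun hw z
      | algebraMap r => simp
      | add a b _ _ ha hb => rw [map_add, map_add, ha, hb, add_zero]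
      | mul a b _ _ ha hb => simp [Derivation.leibniz, ha, hb]
    have key : ∀ (a : MvPolynomial σ K)
        (Q : Polynomial (Algebra.adjoin K (Set.range ((↑) : Z → MvPolynomial σ K)))),
        eval x (dirDeriv w (Polynomial.aeval a Q)) =
          eval x (Polynomial.aeval a (Polynomial.derivative Q)) * eval x (dirDeriv w a) := by
      intro a Q
      induction Q using Polynomial.induction_on' with
      | add p q hp hq => simp only [map_add, hp, hq, add_mul]
      | monomial n c =>
        rw [Polynomial.aeval_monomial, Polynomial.derivative_monomial, Polynomial.aeval_monomial,
          Derivation.leibniz, Derivation.leibniz_pow]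
        have := hcoef c.1 c.2
        rw [show algebraMap _ (MvPolynomial σ K) c = c.1 from rfl,
          show algebraMap _ (MvPolynomial σ K) (c * (n : Algebra.adjoin K (Set.range
            ((↑) : Z → MvPolynomial σ K)))) = c.1 * n from by rw [map_mul, map_natCast]; rfl]
        simp only [smul_eq_mul, map_add, map_mul, nsmul_eq_mul, this, map_natCast]
        ring
    ext i
    have h1 := key (X i) (P i)
    rw [hP, map_zero, map_zero] at h1
    simpa [dirDeriv, mkDerivation_X] using (mul_eq_zero.1 h1.symm).resolve_left
      (hx i (Finset.mem_univ _))
  have hsurj : Function.Surjective (differential ((↑) : Z → MvPolynomial σ K) x) := by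
    refine (LinearMap.injective_iff_surjective_of_finrank_eq_finrank ?_).1 hinj
    simp [Fintype.card_congr e]
  intro y
  obtain ⟨w, hw⟩ := hsurj fun z => if h : ∃ i, f i = z then y h.choose else 0
  refine ⟨w, funext fun i => ?_⟩
  have h1 := congrFun hw ⟨f i, hfZ ⟨i, rfl⟩⟩
  have h2 : ∃ i', f i' = f i := ⟨i, rfl⟩
  rw [differential_apply] at h1 ⊢
  rw [h1, dif_pos h2, hf.injective h2.choose_spec]

end Differentials

/-! ### Chains of primes and the rank of the differential -/

section Ranks

open MvPolynomial

variable {K : Type*} [Field K]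

/-- If `a` is algebraically independent modulo `q` and `p < q` with `p` prime, then adjoining any
element of `q` outside `p` gives a family which is algebraically independent modulo `p`. -/
lemma exists_cons_independent {S : Type*} [CommRing S] [Algebra K S] {p q : Ideal S}
    (hp : p.IsPrime) (hpq : p < q) {m : ℕ} {a : Fin m → S}
    (ha : ∀ P : MvPolynomial (Fin m) K, aeval a P ∈ q → P = 0) :
    ∃ b : Fin (m + 1) → S, ∀ P : MvPolynomial (Fin (m + 1)) K, aeval b P ∈ p → P = 0 := by
  obtain ⟨c, hcq, hcp⟩ := SetLike.exists_of_lt hpq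
  -- A relation between `c` and `a` is a polynomial in `c`. Modulo `q` its constant coefficient is
  -- a relation between the `a i`, so it vanishes, and a factor `c` can be cancelled modulo `p`.
  set ev : Polynomial (MvPolynomial (Fin m) K) →+* S :=
    Polynomial.eval₂RingHom (aeval a : MvPolynomial (Fin m) K →ₐ[K] S).toRingHom c with hev
  have key : ∀ n (Q : Polynomial (MvPolynomial (Fin m) K)), Q.natDegree ≤ n → ev Q ∈ p → Q = 0 := by
    intro n
    induction n with
    | zero =>
      intro Q hn hQ
      rw [Polynomial.eq_C_of_natDegree_le_zero hn] at hQ ⊢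
      have h1 : aeval a (Q.coeff 0) ∈ p := by simpa [hev] using hQ
      rw [ha _ (hpq.le h1), Polynomial.C_0]
    | succ n ih =>
      intro Q hn hQ
      have h0 : ev Q = c * ev Q.divX + aeval a (Q.coeff 0) := by
        conv_lhs => rw [← Polynomial.divX_mul_X_add Q]
        rw [map_add, map_mul, mul_comm]
        simp [hev]
      have h1 : aeval a (Q.coeff 0) ∈ q := by
        have := q.sub_mem (hpq.le hQ) (q.mul_mem_right (ev Q.divX) hcq)
        rwa [h0, add_sub_cancel_left] at this
      have h2 := ha _ h1
      rw [h0, h2, map_zero, add_zero] at hQ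
      have h3 := ih Q.divX (by rw [Polynomial.natDegree_divX_eq_natDegree_tsub_one]; omega)
        ((hp.mem_or_mem hQ).resolve_left hcp)
      rw [← Polynomial.divX_mul_X_add Q, h3, h2, zero_mul, Polynomial.C_0, zero_add]
  refine ⟨Fin.cons c a, fun P hP => ?_⟩
  have h : ev (finSuccEquiv K m P) = aeval (Fin.cons c a : Fin (m + 1) → S) P := by
    have : ev.comp (finSuccEquiv K m).toRingEquiv.toRingHom =
        (aeval (Fin.cons c a : Fin (m + 1) → S) :
          MvPolynomial (Fin (m + 1)) K →ₐ[K] S).toRingHom := by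
      refine MvPolynomial.ringHom_ext (fun r => ?_) fun i => ?_
      · simp [hev, finSuccEquiv_apply]
      · refine Fin.cases ?_ (fun i => ?_) i <;> simp [hev, finSuccEquiv_apply]
    exact congrArg (fun g : _ →+* S => g P) this
  rw [← h] at hP
  exact (finSuccEquiv K m).map_eq_zero_iff.1 (key _ _ le_rfl hP)

/-- A strictly decreasing chain of `m + 1` primes yields `m` elements which are algebraically
independent modulo the smallest one. -/
lemma exists_independent_of_chain {S : Type*} [CommRing S] [Algebra K S] (I : ℕ → Ideal S)
    (m : ℕ) (hI : ∀ i ≤ m, (I i).IsPrime) (hlt : ∀ i < m, I (i + 1) < I i) :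
    ∃ a : Fin m → S, ∀ P : MvPolynomial (Fin m) K, aeval a P ∈ I m → P = 0 := by
  induction m with
  | zero =>
    refine ⟨Fin.elim0, fun P hP => ?_⟩
    by_contra h
    rw [eq_C_of_isEmpty P] at h hP
    rw [aeval_C] at hP
    refine (hI 0 le_rfl).ne_top (Ideal.eq_top_of_isUnit_mem _ hP (IsUnit.map _ ?_))
    exact (isUnit_iff_ne_zero.2 fun h0 => h (by rw [h0, C_0]))
  | succ m ih =>
    obtain ⟨a, ha⟩ := ih (fun i hi => hI i (by omega)) fun i hi => hlt i (by omega)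
    exact exists_cons_independent (hI _ le_rfl) (hlt m (by omega)) ha

/-- Vectors with independent images, and linear forms reading off the coordinates. -/
lemma exists_dual_family {m : ℕ} {F : Type*} [AddCommGroup F] [Module K F] (u : Fin m → F)
    (hu : LinearIndependent K u) :
    ∃ Q : F →ₗ[K] (Fin m → K), ∀ l, Q (u l) = Pi.single l 1 := by
  obtain ⟨g, hg⟩ := LinearMap.exists_leftInverse_of_injective (Fintype.linearCombination K u)
    (LinearMap.ker_eq_bot.2 hu.fintypeLinearCombination_injective)
  refine ⟨g, fun l => ?_⟩
  have := congrArg (fun h : _ →ₗ[K] _ => h (Pi.single l 1)) hg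
  simpa [Fintype.linearCombination_apply_single] using this

/-- There are at most `m` algebraically independent polynomials in `m` variables. -/
lemma not_algebraicIndependent_of_lt {m m' : ℕ} (h : m < m') (f : Fin m' → MvPolynomial (Fin m) K) :
    ¬ AlgebraicIndependent K f := by
  intro hf
  have h1 := hf.lift_cardinalMk_le_trdeg
  rw [MvPolynomial.trdeg_of_isDomain] at h1
  simp at h1
  omega

variable {σ : Type*} {ι : Type*}

/-- The polynomial map `Φ` restricted to the span of the vectors `w l`. -/
def restrict {m : ℕ} (Φ : ι → MvPolynomial σ K) (w : Fin m → σ → K) (j : ι) :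
    MvPolynomial (Fin m) K :=
  aeval (fun i => ∑ l, C (w l i) * X l) (Φ j)

lemma eval_restrict {m : ℕ} (Φ : ι → MvPolynomial σ K) (w : Fin m → σ → K) (j : ι)
    (c : Fin m → K) : eval c (restrict Φ w j) = eval (∑ l, c l • w l) (Φ j) := by
  rw [restrict, ← coe_aeval_eq_eval, ← coe_aeval_eq_eval]
  change aeval c (aeval _ (Φ j)) = aeval _ (Φ j)
  rw [comp_aeval_apply]
  congr 2
  ext i
  simp [mul_comm]

lemma restrict_isHomogeneous {m D : ℕ} {Φ : ι → MvPolynomial σ K}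
    (hΦ : ∀ j, (Φ j).IsHomogeneous D) (w : Fin m → σ → K) (j : ι) :
    (restrict Φ w j).IsHomogeneous D := by
  have := (hΦ j).aeval (fun i => ∑ l, C (w l i) * X l) (n := 1) fun i =>
    IsHomogeneous.sum _ _ _ fun l _ => by
      simpa using (isHomogeneous_C (Fin m) (w l i)).mul (isHomogeneous_X K l)
  simpa [restrict] using this

variable [Fintype σ]

lemma differential_restrict {m : ℕ} (Φ : ι → MvPolynomial σ K) (w : Fin m → σ → K)
    (c : Fin m → K) (l : Fin m) :
    differential (restrict Φ w) c (Pi.single l 1) = differential Φ (∑ l, c l • w l) (w l) := by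
  ext j
  rw [differential_apply, differential_apply, restrict, derivation_aeval, dirDeriv_apply, map_sum,
    map_sum]
  refine Finset.sum_congr rfl fun i _ => ?_
  have h1 : dirDeriv (Pi.single l 1 : Fin m → K) (∑ l, C (w l i) * X l) = C (w l i) := by
    rw [map_sum, Finset.sum_eq_single l]
    · simp [dirDeriv, mkDerivation_X]
    · intro b _ hb
      simp [dirDeriv, mkDerivation_X, hb]
    · simp
  have h2 := eval_restrict (fun i' => pderiv i' (Φ j)) w i c
  rw [restrict] at h2
  rw [h1, map_mul, h2, map_mul, mul_comm, eval_C, eval_C]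

variable [Fintype ι]

/-- The differential of polynomials in the `Φ j` factors through the differential of `Φ`. -/
lemma differential_aeval {ι' : Type*} (Φ : ι → MvPolynomial σ K) (a : ι' → MvPolynomial ι K)
    (x : σ → K) :
    ∃ L : (ι → K) →ₗ[K] (ι' → K),
      differential (fun i => aeval Φ (a i)) x = L ∘ₗ differential Φ x := by
  refine ⟨LinearMap.pi fun i => ∑ j, eval x (aeval Φ (pderiv j (a i))) • LinearMap.proj j, ?_⟩
  refine LinearMap.ext fun w => funext fun i => ?_
  rw [differential_apply, derivation_aeval, map_sum]
  simp only [LinearMap.coe_comp, Function.comp_apply, LinearMap.pi_apply, LinearMap.sum_apply,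
    LinearMap.smul_apply, LinearMap.proj_apply, differential_apply, smul_eq_mul, map_mul]

/-- The length of a chain of primes above the kernel of `y ↦ Φ` is bounded by the maximal rank
of the differential of `Φ`. -/
lemma chain_length_le [CharZero K] (Φ : ι → MvPolynomial σ K) {r : ℕ}
    (hr : ∀ x, Module.finrank K (LinearMap.range (differential Φ x)) ≤ r)
    (I : ℕ → Ideal (MvPolynomial ι K)) (m : ℕ) (hI : ∀ i ≤ m, (I i).IsPrime)
    (hlt : ∀ i < m, I (i + 1) < I i) (hker : ∀ f, aeval Φ f = 0 → f ∈ I m) : m ≤ r := by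
  obtain ⟨a, ha⟩ := exists_independent_of_chain (K := K) I m hI hlt
  have hind : AlgebraicIndependent K fun i => aeval Φ (a i) := by
    rw [algebraicIndependent_iff]
    intro P hP
    refine ha P (hker _ ?_)
    rw [← hP]
    exact comp_aeval_apply (f := a) (aeval Φ) P
  obtain ⟨x, hx⟩ := exists_differential_surjective _ hind
  obtain ⟨L, hL⟩ := differential_aeval Φ a x
  rw [hL, LinearMap.coe_comp] at hx
  have h1 : LinearMap.range (L ∘ₗ (LinearMap.range (differential Φ x)).subtype) = ⊤ := by
    rw [eq_top_iff]
    rintro y -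
    obtain ⟨w, rfl⟩ := hx y
    exact ⟨⟨_, w, rfl⟩, rfl⟩
  have h2 := LinearMap.finrank_range_le (L ∘ₗ (LinearMap.range (differential Φ x)).subtype)
  rw [h1, finrank_top, Module.finrank_fin_fun] at h2
  exact h2.trans (hr x)

/-- The `a`-th component of a linear map `Q`, as a linear form in the variables. -/
def linComb {m : ℕ} (Q : (ι → K) →ₗ[K] (Fin m → K)) (a : Fin m) : MvPolynomial ι K := by
  classical exact ∑ j, C (Q (Pi.single j 1) a) * X j

lemma differential_linComb {m : ℕ} (Q : (ι → K) →ₗ[K] (Fin m → K)) (Φ : ι → MvPolynomial σ K)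
    (x w : σ → K) (a : Fin m) :
    eval x (dirDeriv w (aeval Φ (linComb Q a))) = Q (differential Φ x w) a := by
  classical
  rw [derivation_aeval, map_sum]
  conv_rhs => rw [← (Pi.basisFun K ι).sum_repr (differential Φ x w), map_sum, Finset.sum_apply]
  refine Finset.sum_congr rfl fun j _ => ?_
  have : pderiv j (linComb Q a) = C (Q (Pi.single j 1) a) := by
    simp only [linComb, map_sum, Derivation.leibniz, pderiv_X, pderiv_C, add_zero,
      smul_eq_mul, Pi.single_apply, mul_ite, mul_one, mul_zero]
    rw [Finset.sum_eq_single j (fun b _ hb => by simp [hb]) (by simp)]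
    simp
  rw [this, aeval_C, map_mul, algebraMap_eq, eval_C]
  simp [differential_apply, mul_comm]

/-- Lower semicontinuity of the rank of the differential. -/
lemma exists_rank_le (Φ : ι → MvPolynomial σ K) (x₀ : σ → K) :
    ∃ g : MvPolynomial σ K, eval x₀ g ≠ 0 ∧ ∀ x, eval x g ≠ 0 →
      Module.finrank K (LinearMap.range (differential Φ x₀)) ≤
        Module.finrank K (LinearMap.range (differential Φ x)) := by
  set b := Module.finBasis K (LinearMap.range (differential Φ x₀)) with hb
  choose w hw using fun l => (b l).2
  obtain ⟨Q, hQ⟩ := exists_dual_family (fun l => (b l : ι → K))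
    (b.linearIndependent.map' (Submodule.subtype _) (Submodule.ker_subtype _))
  -- A minor of the Jacobian matrix, in suitable linear coordinates, which is `1` at `x₀`.
  set M : Matrix (Fin _) (Fin _) (MvPolynomial σ K) :=
    Matrix.of fun l a => dirDeriv (w l) (aeval Φ (linComb Q a)) with hM
  have hev : ∀ x, eval x M.det = (Matrix.of fun l => Q (differential Φ x (w l))).det := by
    intro x
    rw [RingHom.map_det]
    congr 1
    ext l a
    exact differential_linComb Q Φ x (w l) a
  refine ⟨M.det, ?_, fun x hx => ?_⟩
  · rw [hev]
    have : (Matrix.of fun l => Q (differential Φ x₀ (w l))) = 1 := by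
      ext l a
      rw [Matrix.of_apply, hw, hQ, Matrix.one_apply, Pi.single_apply]
      simp [eq_comm]
    rw [this, Matrix.det_one]
    exact one_ne_zero
  · rw [hev] at hx
    have h1 : LinearIndependent K fun l => Q (differential Φ x (w l)) :=
      Matrix.linearIndependent_rows_of_det_ne_zero hx
    have h2 : LinearIndependent K fun l => differential Φ x (w l) :=
      LinearIndependent.of_comp Q h1
    have h3 : LinearIndependent K fun l => (⟨differential Φ x (w l), w l, rfl⟩ :
        LinearMap.range (differential Φ x)) :=
      LinearIndependent.of_comp (Submodule.subtype _) h2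
    simpa using h3.fintype_card_le_finrank

/-- If the differential of `Φ` is injective on the span of the `w l` at a point of that span, the
restriction of `Φ` to the span has `m` algebraically independent coordinate functions. -/
lemma exists_restrict_independent [CharZero K] {m : ℕ} (Φ : ι → MvPolynomial σ K)
    (w : Fin m → σ → K) (c : Fin m → K)
    (h : LinearIndependent K fun l => differential Φ (∑ l, c l • w l) (w l)) :
    ∃ G : Fin m → MvPolynomial ι K,
      AlgebraicIndependent K fun a => aeval (restrict Φ w) (G a) := by
  obtain ⟨Q, hQ⟩ := exists_dual_family _ h
  refine ⟨linComb Q, algebraicIndependent_of_det_ne_zero _ c (fun l => Pi.single l 1) ?_⟩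
  have : (Matrix.of fun l a => eval c (dirDeriv (Pi.single l 1 : Fin m → K)
      (aeval (restrict Φ w) (linComb Q a)))) = 1 := by
    ext l a
    rw [Matrix.of_apply, differential_linComb, differential_restrict, hQ, Matrix.one_apply,
      Pi.single_apply]
    simp [eq_comm]
  rw [this, Matrix.det_one]
  exact one_ne_zero

end Ranks

/-! ### The dimension of the image of a homogeneous polynomial map -/

section ProjectiveDimension

open MvPolynomial

variable {K : Type*} [Field K] {E : Type*} [AddCommGroup E] [Module K E] [FiniteDimensional K E]

attribute [local instance] zariskiTopology

variable (K E) in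
/-- The coordinates with respect to the fixed basis of `E` used by `evalAt`. -/
def coords : E ≃ₗ[K] (Fin (Module.finrank K E) → K) := (Module.finBasis K E).equivFun

lemma evalAt_eq (f : MvPolynomial (Fin (Module.finrank K E)) K) (x : E) :
    evalAt K E f x = eval (coords K E x) f := rfl

/-- The restriction of polynomials to the line through `x`, as polynomials in one variable. -/
def lineRestriction (x : E) : MvPolynomial (Fin (Module.finrank K E)) K →ₐ[K] Polynomial K :=
  aeval fun i => Polynomial.C (coords K E x i) * Polynomial.X

lemma eval_lineRestriction (x : E) (f : MvPolynomial (Fin (Module.finrank K E)) K) (c : K) :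
    (lineRestriction x f).eval c = evalAt K E f (c • x) := by
  rw [evalAt_eq, ← Polynomial.coe_aeval_eq_eval, ← coe_aeval_eq_eval]
  change Polynomial.aeval c (aeval _ f) = aeval _ f
  rw [comp_aeval_apply]
  congr 2
  funext i
  rw [map_mul, Polynomial.aeval_C, Polynomial.aeval_X, map_smul, Pi.smul_apply, smul_eq_mul,
    mul_comm]
  rfl

lemma coeff_lineRestriction (x : E) (f : MvPolynomial (Fin (Module.finrank K E)) K) (d : ℕ) :
    (lineRestriction x f).coeff d = evalAt K E (homogeneousComponent d f) x := by
  classical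
  rw [evalAt_eq]
  induction f using MvPolynomial.induction_on' with
  | add p q hp hq => rw [map_add, Polynomial.coeff_add, hp, hq, map_add, map_add]
  | monomial s r =>
    have h1 : lineRestriction x (monomial s r) =
        Polynomial.C (eval (coords K E x) (monomial s r)) * Polynomial.X ^ s.degree := by
      rw [lineRestriction, aeval_monomial, eval_monomial, Finsupp.prod, Finsupp.prod, map_mul,
        map_prod, Finsupp.degree_apply, ← Finset.prod_pow_eq_pow_sum, mul_assoc,
        ← Finset.prod_mul_distrib]
      congr 1
      exact Finset.prod_congr rfl fun i _ => by rw [mul_pow, map_pow]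
    rw [h1, Polynomial.coeff_C_mul_X_pow, homogeneousComponent_of_mem (n := s.degree)
      ((mem_homogeneousSubmodule _ _).2 (isHomogeneous_monomial r rfl))]
    split_ifs <;> simp

lemma lineRestriction_eq_zero_iff {d : ℕ} {f : MvPolynomial (Fin (Module.finrank K E)) K}
    (hf : f.IsHomogeneous d) (x : E) : lineRestriction x f = 0 ↔ evalAt K E f x = 0 := by
  constructor
  · intro h
    rw [← homogeneousComponent_eq_self hf, ← coeff_lineRestriction, h, Polynomial.coeff_zero]
  · intro h
    ext i
    rw [coeff_lineRestriction, homogeneousComponent_of_mem ((mem_homogeneousSubmodule _ _).2 hf)]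
    split_ifs
    · simpa using h
    · simp [evalAt_eq]

lemma isOpen_lineRestriction_ne_zero (f : MvPolynomial (Fin (Module.finrank K E)) K) :
    IsOpen {P : ℙ K E | lineRestriction P.rep f ≠ 0} := by
  have : {P : ℙ K E | lineRestriction P.rep f ≠ 0} =
      ⋃ d, {P : ℙ K E | evalAt K E (homogeneousComponent d f) P.rep ≠ 0} := by
    ext P
    simp only [Set.mem_ofPred_eq, Set.mem_iUnion, ← coeff_lineRestriction, ne_eq,
      Polynomial.ext_iff, Polynomial.coeff_zero, not_forall]
  rw [this]
  exact isOpen_iUnion fun d => TopologicalSpace.isOpen_generateFrom_of_mem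
    ⟨d, _, homogeneousComponent_isHomogeneous d f, rfl⟩

/-- The complements of hypersurfaces form a basis of the Zariski topology. -/
lemma exists_isHomogeneous_of_mem_isOpen {U : Set (ℙ K E)} (hU : IsOpen U) {P : ℙ K E}
    (hP : P ∈ U) :
    ∃ (d : ℕ) (f : MvPolynomial (Fin (Module.finrank K E)) K), f.IsHomogeneous d ∧
      evalAt K E f P.rep ≠ 0 ∧ ∀ Q : ℙ K E, evalAt K E f Q.rep ≠ 0 → Q ∈ U := by
  induction hU with
  | basic s hs =>
    obtain ⟨d, f, hf, rfl⟩ := hs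
    exact ⟨d, f, hf, hP, fun Q hQ => hQ⟩
  | univ => exact ⟨0, 1, isHomogeneous_one _ _, by simp [evalAt_eq], fun _ _ => trivial⟩
  | inter s t _ _ hs ht =>
    obtain ⟨d, f, hf, hfP, hf'⟩ := hs hP.1
    obtain ⟨e, g, hg, hgP, hg'⟩ := ht hP.2
    refine ⟨d + e, f * g, hf.mul hg, ?_, fun Q hQ => ?_⟩
    · rw [evalAt_eq, map_mul]
      exact mul_ne_zero hfP hgP
    · rw [evalAt_eq, map_mul] at hQ
      exact ⟨hf' Q (left_ne_zero_of_mul hQ), hg' Q (right_ne_zero_of_mul hQ)⟩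
  | sUnion S _ hS =>
    obtain ⟨s, hs, hPs⟩ := hP
    obtain ⟨d, f, hf, hfP, hf'⟩ := hS s hs hPs
    exact ⟨d, f, hf, hfP, fun Q hQ => ⟨s, hs, hf' Q hQ⟩⟩

/-- The ideal of polynomials vanishing on the affine cone over a set of points. -/
def coneIdeal (Z : Set (ℙ K E)) : Ideal (MvPolynomial (Fin (Module.finrank K E)) K) :=
  ⨅ P ∈ Z, RingHom.ker (lineRestriction P.rep)

lemma mem_coneIdeal {Z : Set (ℙ K E)} {f : MvPolynomial (Fin (Module.finrank K E)) K} :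
    f ∈ coneIdeal Z ↔ ∀ P ∈ Z, lineRestriction P.rep f = 0 := by
  simp [coneIdeal, Submodule.mem_iInf]

lemma coneIdeal_anti {Z Z' : Set (ℙ K E)} (h : Z ⊆ Z') : coneIdeal Z' ≤ coneIdeal Z :=
  fun _ hf => mem_coneIdeal.2 fun P hP => mem_coneIdeal.1 hf P (h hP)

lemma coneIdeal_closure (Z : Set (ℙ K E)) : coneIdeal (closure Z) = coneIdeal Z := by
  refine le_antisymm (coneIdeal_anti subset_closure) fun f hf => mem_coneIdeal.2 fun P hP => ?_
  by_contra h
  obtain ⟨Q, hQ, hQZ⟩ := mem_closure_iff.1 hP _ (isOpen_lineRestriction_ne_zero f) h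
  exact hQ (mem_coneIdeal.1 hf Q hQZ)

lemma coneIdeal_isPrime {Z : Set (ℙ K E)} (hZ : IsIrreducible Z) : (coneIdeal Z).IsPrime := by
  rw [Ideal.isPrime_iff]
  constructor
  · obtain ⟨P, hP⟩ := hZ.nonempty
    intro h
    have := mem_coneIdeal.1 (h ▸ Submodule.mem_top : (1 : MvPolynomial _ K) ∈ coneIdeal Z) P hP
    simp at this
  · intro f g hfg
    by_contra! h
    simp only [mem_coneIdeal, not_forall] at h
    obtain ⟨⟨P, hP, hPf⟩, Q, hQ, hQg⟩ := h
    obtain ⟨R, hR, hRf, hRg⟩ := hZ.isPreirreducible _ _ (isOpen_lineRestriction_ne_zero f)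
      (isOpen_lineRestriction_ne_zero g) ⟨P, hP, hPf⟩ ⟨Q, hQ, hQg⟩
    have := mem_coneIdeal.1 hfg R hR
    rw [map_mul] at this
    exact (mul_ne_zero hRf hRg) this

lemma coneIdeal_strictAnti {Z Z' : Set (ℙ K E)} (hZ : IsClosed Z) (h : Z ⊂ Z') :
    coneIdeal Z' < coneIdeal Z := by
  refine lt_of_le_of_ne (coneIdeal_anti h.1) fun heq => ?_
  obtain ⟨P, hP, hPZ⟩ := Set.exists_of_ssubset h
  obtain ⟨d, f, hf, hfP, hf'⟩ := exists_isHomogeneous_of_mem_isOpen hZ.isOpen_compl hPZ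
  have : f ∈ coneIdeal Z := mem_coneIdeal.2 fun Q hQ =>
    (lineRestriction_eq_zero_iff hf _).2 (by_contra fun h0 => hf' Q h0 hQ)
  rw [← heq] at this
  exact hfP ((lineRestriction_eq_zero_iff hf _).1 (mem_coneIdeal.1 this P hP))

/-- The ideal of a nonempty cone is strictly contained in the ideal of the vertex. -/
lemma coneIdeal_lt_ker_eval_zero {Z : Set (ℙ K E)} (hZ : Z.Nonempty) :
    coneIdeal Z < RingHom.ker (eval (0 : Fin (Module.finrank K E) → K)) := by
  obtain ⟨P, hP⟩ := hZ
  refine lt_of_le_of_ne (fun f hf => ?_) fun heq => ?_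
  · have h1 := eval_lineRestriction P.rep f 0
    rw [mem_coneIdeal.1 hf P hP, Polynomial.eval_zero, zero_smul, evalAt_eq, map_zero] at h1
    exact h1.symm
  · apply P.rep_nonzero
    rw [← (coords K E).map_eq_zero_iff]
    ext j
    have h1 : (X j : MvPolynomial _ K) ∈ coneIdeal Z := by
      rw [heq, RingHom.mem_ker, eval_X, Pi.zero_apply]
    have h2 := (lineRestriction_eq_zero_iff (isHomogeneous_X K j) _).1 (mem_coneIdeal.1 h1 P hP)
    rwa [evalAt_eq, eval_X] at h2

variable {τ : Type*}

/-- The points of projective space parametrised by a polynomial map to `E`, where the components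
of the map are taken in the coordinates of `E`. -/
def imagePoints (Ψ : Fin (Module.finrank K E) → MvPolynomial τ K) : Set (ℙ K E) :=
  {Q | ∃ a, coords K E Q.rep = fun j => eval a (Ψ j)}

lemma eval_aeval {ι : Type*} (Ψ : ι → MvPolynomial τ K) (F : MvPolynomial ι K) (c : τ → K) :
    eval c (aeval Ψ F) = eval (fun j => eval c (Ψ j)) F := by
  rw [← coe_aeval_eq_eval, ← coe_aeval_eq_eval]
  exact comp_aeval_apply (f := Ψ) (aeval c) F

lemma eval_smul_of_isHomogeneous {D : ℕ} {f : MvPolynomial τ K} (hf : f.IsHomogeneous D)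
    (c : K) (a : τ → K) : eval (c • a) f = c ^ D * eval a f := by
  rw [eval_eq, eval_eq, Finset.mul_sum]
  refine Finset.sum_congr rfl fun m hm => ?_
  have h1 : ∑ i ∈ m.support, m i = D := by
    have := hf (mem_support_iff.1 hm)
    rw [Finsupp.weight_apply, Finsupp.sum] at this
    simpa using this
  simp only [Pi.smul_apply, smul_eq_mul, mul_pow, Finset.prod_mul_distrib,
    Finset.prod_pow_eq_pow_sum, h1]
  ring

/-- Over an algebraically closed field the image of a homogeneous polynomial map of positive
degree is a cone. -/
lemma exists_eval_eq_smul [IsAlgClosed K] {ι : Type*} {D : ℕ} (hD : D ≠ 0)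
    {Ψ : ι → MvPolynomial τ K} (hΨ : ∀ j, (Ψ j).IsHomogeneous D) (a : τ → K) (c : K) :
    ∃ a', (fun j => eval a' (Ψ j)) = c • fun j => eval a (Ψ j) := by
  obtain ⟨z, hz⟩ := IsAlgClosed.exists_pow_nat_eq c (Nat.pos_of_ne_zero hD)
  refine ⟨z • a, funext fun j => ?_⟩
  rw [eval_smul_of_isHomogeneous (hΨ j), hz, Pi.smul_apply, smul_eq_mul]

section Cone

variable [IsAlgClosed K] {D : ℕ} (hD : D ≠ 0)
  {Ψ : Fin (Module.finrank K E) → MvPolynomial τ K} (hΨ : ∀ j, (Ψ j).IsHomogeneous D)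

include hD hΨ

lemma mk_mem_imagePoints {x : E} (hx : x ≠ 0) {a : τ → K}
    (ha : coords K E x = fun j => eval a (Ψ j)) : Projectivization.mk K x hx ∈ imagePoints Ψ := by
  obtain ⟨u, hu⟩ := Projectivization.exists_smul_eq_mk_rep K x hx
  obtain ⟨a', ha'⟩ := exists_eval_eq_smul hD hΨ a (u : K)
  refine ⟨a', ?_⟩
  rw [← hu, ha', ← ha, Units.smul_def, map_smul]

lemma imagePoints_nonempty (h0 : Ψ ≠ 0) : (imagePoints Ψ).Nonempty := by
  obtain ⟨j, hj⟩ := Function.ne_iff.1 h0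
  obtain ⟨a, ha⟩ := exists_eval_ne_zero hj
  refine ⟨_, mk_mem_imagePoints hD hΨ (x := (coords K E).symm fun j => eval a (Ψ j)) ?_
    (LinearEquiv.apply_symm_apply _ _)⟩
  intro h
  rw [LinearEquiv.map_eq_zero_iff] at h
  exact ha (congrFun h j)

lemma imagePoints_irreducible (h0 : Ψ ≠ 0) : IsIrreducible (imagePoints Ψ) := by
  refine ⟨imagePoints_nonempty hD hΨ h0, ?_⟩
  rintro U V hU hV ⟨P, ⟨a, ha⟩, hPU⟩ ⟨Q, ⟨b, hb⟩, hQV⟩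
  obtain ⟨d, f, hf, hfP, hf'⟩ := exists_isHomogeneous_of_mem_isOpen hU hPU
  obtain ⟨e, g, hg, hgQ, hg'⟩ := exists_isHomogeneous_of_mem_isOpen hV hQV
  obtain ⟨j, hj⟩ := Function.ne_iff.1 h0
  have h1 : aeval Ψ f ≠ 0 := by
    intro h
    rw [evalAt_eq, ha, ← eval_aeval, h, map_zero] at hfP
    exact hfP rfl
  have h2 : aeval Ψ g ≠ 0 := by
    intro h
    rw [evalAt_eq, hb, ← eval_aeval, h, map_zero] at hgQ
    exact hgQ rfl
  obtain ⟨c, hc⟩ := exists_eval_ne_zero (mul_ne_zero (mul_ne_zero h1 h2) hj)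
  rw [map_mul, map_mul, eval_aeval, eval_aeval] at hc
  set x : E := (coords K E).symm fun j => eval c (Ψ j) with hx
  have hxc : coords K E x = fun j => eval c (Ψ j) := LinearEquiv.apply_symm_apply _ _
  have hx0 : x ≠ 0 := by
    intro h
    rw [hx, LinearEquiv.map_eq_zero_iff] at h
    exact right_ne_zero_of_mul hc (congrFun h j)
  obtain ⟨u, hu⟩ := Projectivization.exists_smul_eq_mk_rep K x hx0
  have hval : ∀ {F : MvPolynomial (Fin (Module.finrank K E)) K} {n : ℕ}, F.IsHomogeneous n →
      eval (fun j => eval c (Ψ j)) F ≠ 0 → evalAt K E F (Projectivization.mk K x hx0).rep ≠ 0 := by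
    intro F n hF h
    rw [← hu, evalAt_eq, Units.smul_def, map_smul, eval_smul_of_isHomogeneous hF, hxc]
    exact mul_ne_zero (pow_ne_zero _ u.ne_zero) h
  exact ⟨_, mk_mem_imagePoints hD hΨ hx0 hxc,
    hf' _ (hval hf (left_ne_zero_of_mul (left_ne_zero_of_mul hc))),
    hg' _ (hval hg (right_ne_zero_of_mul (left_ne_zero_of_mul hc)))⟩

/-- The ideal of the cone over the image consists of the relations between the components. -/
lemma mem_coneIdeal_imagePoints (h0 : Ψ ≠ 0) {f : MvPolynomial (Fin (Module.finrank K E)) K} :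
    f ∈ coneIdeal (imagePoints Ψ) ↔ aeval Ψ f = 0 := by
  rw [mem_coneIdeal]
  constructor
  · intro h
    refine MvPolynomial.funext fun a => ?_
    rw [eval_aeval, map_zero]
    set x : E := (coords K E).symm fun j => eval a (Ψ j) with hx
    have hxa : coords K E x = fun j => eval a (Ψ j) := LinearEquiv.apply_symm_apply _ _
    rw [← hxa, ← evalAt_eq]
    by_cases hx0 : x = 0
    · obtain ⟨P, hP⟩ := imagePoints_nonempty hD hΨ h0
      rw [hx0, ← zero_smul K P.rep, ← eval_lineRestriction, h P hP, Polynomial.eval_zero]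
    · obtain ⟨u, hu⟩ := Projectivization.exists_smul_eq_mk_rep K x hx0
      have h1 := h _ (mk_mem_imagePoints hD hΨ hx0 hxa)
      have h2 : x = (↑u⁻¹ : K) • (Projectivization.mk K x hx0).rep := by
        rw [← hu, ← Units.smul_def, inv_smul_smul]
      rw [h2, ← eval_lineRestriction, h1, Polynomial.eval_zero]
  · rintro h P ⟨a, ha⟩
    refine Polynomial.funext fun c => ?_
    obtain ⟨a', ha'⟩ := exists_eval_eq_smul hD hΨ a c
    rw [eval_lineRestriction, evalAt_eq, map_smul, ha, ← ha', ← eval_aeval, h, map_zero,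
      Polynomial.eval_zero]

end Cone

variable {σ : Type*} [Fintype σ]

/-- Euler's identity. -/
lemma differential_self {ι : Type*} {D : ℕ} {Φ : ι → MvPolynomial σ K}
    (hΦ : ∀ j, (Φ j).IsHomogeneous D) (x : σ → K) :
    differential Φ x x = (D : K) • fun j => eval x (Φ j) := by
  ext j
  have h := congrArg (eval x) (hΦ j).sum_X_mul_pderiv
  rw [differential_apply, dirDeriv_apply, map_sum]
  simpa using h

/-- A nonzero vector is the first member of an independent family of maximal size. -/
lemma exists_linearIndependent_extending {F : Type*} [AddCommGroup F] [Module K F]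
    [FiniteDimensional K F] {u₀ : F} (hu : u₀ ≠ 0) (m : ℕ) (hm : m + 1 ≤ Module.finrank K F) :
    ∃ u : Fin (m + 1) → F, u 0 = u₀ ∧ LinearIndependent K u := by
  induction m with
  | zero => exact ⟨fun _ => u₀, rfl, (linearIndependent_unique_iff (ι := Fin 1)).2 hu⟩
  | succ m ih =>
    obtain ⟨u, hu0, hu⟩ := ih (by omega)
    obtain ⟨x, hx⟩ := exists_linearIndependent_snoc_of_lt_finrank hu (by omega)
    refine ⟨Fin.snoc u x, ?_, hx⟩
    rw [← Fin.castSucc_zero, Fin.snoc_castSucc, hu0]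

variable [IsAlgClosed K] [CharZero K]

lemma isIrreducible_preimage_coe {T : Type*} [TopologicalSpace T] {X Z : Set T} (h : Z ⊆ X)
    (hZ : IsIrreducible Z) : IsIrreducible ((↑) ⁻¹' Z : Set X) := by
  refine ⟨?_, ?_⟩
  · obtain ⟨z, hz⟩ := hZ.nonempty
    exact ⟨⟨z, h hz⟩, hz⟩
  · rintro _ _ ⟨U, hU, rfl⟩ ⟨V, hV, rfl⟩ ⟨x, hx, hxU⟩ ⟨y, hy, hyV⟩
    obtain ⟨z, hz, hzU, hzV⟩ := hZ.isPreirreducible U V hU hV ⟨x, hx, hxU⟩ ⟨y, hy, hyV⟩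
    exact ⟨⟨z, h hz⟩, hz, hzU, hzV⟩

/-- Chains of irreducible closed subsets have length less than the maximal rank of the
differential, by passing to the ideals of the cones. -/
lemma dim_closure_imagePoints_le {D : ℕ} (hD : D ≠ 0)
    {Φ : Fin (Module.finrank K E) → MvPolynomial σ K} (hΦ : ∀ j, (Φ j).IsHomogeneous D)
    (h0 : Φ ≠ 0) {r : ℕ}
    (hr : ∀ x, Module.finrank K (LinearMap.range (differential Φ x)) ≤ r) :
    dim K E (closure (imagePoints Φ)) ≤ (r - 1 : ℕ) := by
  refine iSup_le fun p => ?_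
  suffices p.length + 1 ≤ r by
    have h : p.length ≤ r - 1 := by omega
    exact_mod_cast h
  have hval := Topology.IsInducing.subtypeVal (t := closure (imagePoints Φ))
  set Z : ℕ → TopologicalSpace.IrreducibleCloseds (ℙ K E) := fun i =>
    TopologicalSpace.IrreducibleCloseds.map Subtype.val hval.continuous
      (p ⟨min i p.length, by omega⟩) with hZ
  have hlt : ∀ i < p.length, Z i < Z (i + 1) := by
    intro i hi
    refine TopologicalSpace.IrreducibleCloseds.map_strictMono_of_isInducing hval
      (p.strictMono ?_)
    rw [Fin.mk_lt_mk]
    omega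
  refine chain_length_le Φ hr
    (fun i => i.casesOn (RingHom.ker (eval 0)) fun i => coneIdeal (Z i : Set (ℙ K E)))
    (p.length + 1) ?_ ?_ ?_
  · rintro (_ | i) -
    · exact RingHom.ker_isPrime _
    · exact coneIdeal_isPrime (Z i).isIrreducible
  · rintro (_ | i) hi
    · exact coneIdeal_lt_ker_eval_zero (Z 0).isIrreducible.nonempty
    · exact coneIdeal_strictAnti (Z i).isClosed (hlt i (by omega))
  · intro f hf
    have h1 : (Z p.length : Set (ℙ K E)) ⊆ closure (imagePoints Φ) :=
      closure_minimal (by rintro _ ⟨x, -, rfl⟩; exact x.2) isClosed_closure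
    refine coneIdeal_anti h1 ?_
    rw [coneIdeal_closure]
    exact (mem_coneIdeal_imagePoints hD hΦ h0).2 hf

/-- The projective closure of the image of a homogeneous polynomial map of positive degree has
dimension one less than the maximal rank of the differential. A chain of this length is given by
the images of a flag of linear subspaces which starts at the line through a general point `p` and
on whose members the differential at `p` is injective. -/
theorem dim_closure_imagePoints {D : ℕ} (hD : D ≠ 0)
    {Φ : Fin (Module.finrank K E) → MvPolynomial σ K} (hΦ : ∀ j, (Φ j).IsHomogeneous D)
    (h0 : Φ ≠ 0) {r : ℕ}
    (hr : ∀ x, Module.finrank K (LinearMap.range (differential Φ x)) ≤ r)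
    (hr' : ∃ x, Module.finrank K (LinearMap.range (differential Φ x)) = r) :
    1 ≤ r ∧ dim K E (closure (imagePoints Φ)) = (r - 1 : ℕ) := by
  obtain ⟨x₀, hx₀⟩ := hr'
  obtain ⟨g, hg0, hg⟩ := exists_rank_le Φ x₀
  obtain ⟨j, hj⟩ := Function.ne_iff.1 h0
  have hgne : g ≠ 0 := by rintro rfl; simp at hg0
  obtain ⟨p, hp⟩ := exists_eval_ne_zero (mul_ne_zero hgne hj)
  rw [map_mul] at hp
  have hrank : Module.finrank K (LinearMap.range (differential Φ p)) = r :=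
    le_antisymm (hr p) (hx₀ ▸ hg p (left_ne_zero_of_mul hp))
  have hself : differential Φ p p ≠ 0 := by
    rw [differential_self hΦ]
    intro h
    have := congrFun h j
    simp only [Pi.smul_apply, smul_eq_mul, Pi.zero_apply, mul_eq_zero, Nat.cast_eq_zero] at this
    exact this.elim hD (right_ne_zero_of_mul hp)
  have hr1 : 1 ≤ r := by
    rw [← hrank, Nat.one_le_iff_ne_zero, ← Nat.pos_iff_ne_zero]
    rw [Module.finrank_pos_iff_exists_ne_zero]
    exact ⟨⟨_, p, rfl⟩, fun h => hself (congrArg Subtype.val h)⟩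
  refine ⟨hr1, le_antisymm (dim_closure_imagePoints_le hD hΦ h0 hr) ?_⟩
  -- Independent tangent directions at `p`, the first of which is `p` itself.
  obtain ⟨u, hu0, hu⟩ := exists_linearIndependent_extending (K := K)
    (u₀ := (⟨_, p, rfl⟩ : LinearMap.range (differential Φ p)))
    (fun h => hself (congrArg Subtype.val h)) (r - 1) (by omega)
  have hw' : ∃ w : ℕ → σ → K, w 0 = p ∧
      ∀ l (hl : l < r - 1 + 1), differential Φ p (w l) = u ⟨l, hl⟩ := by
    choose w hw using fun l => (u l).2
    refine ⟨fun l => if l = 0 then p else if h : l < r - 1 + 1 then w ⟨l, h⟩ else 0, rfl, ?_⟩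
    intro l hl
    rcases Nat.eq_zero_or_pos l with rfl | hpos
    · exact congrArg Subtype.val hu0.symm
    · simp only [if_neg hpos.ne', dif_pos hl, hw]
  obtain ⟨w, hw0, hw⟩ := hw'
  set Ψ : ∀ m : ℕ, Fin (Module.finrank K E) → MvPolynomial (Fin m) K :=
    fun m => restrict Φ fun l : Fin m => w l with hΨ
  have hΨhom : ∀ m j, (Ψ m j).IsHomogeneous D := fun m j => restrict_isHomogeneous hΦ _ j
  have hsum : ∀ m, ∑ l : Fin (m + 1), (Pi.single 0 1 : Fin (m + 1) → K) l • w l = p := by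
    intro m
    rw [Finset.sum_eq_single 0 (fun l _ hl => by simp [hl]) (by simp)]
    simp [hw0]
  have hΨ0 : ∀ m, Ψ (m + 1) ≠ 0 := by
    intro m h
    have h1 := eval_restrict Φ (fun l : Fin (m + 1) => w l) j (Pi.single 0 1)
    rw [hsum] at h1
    have h2 : restrict Φ (fun l : Fin (m + 1) => w l) j = 0 := congrFun h j
    rw [h2, map_zero] at h1
    exact right_ne_zero_of_mul hp h1.symm
  have hsub : ∀ m, imagePoints (Ψ m) ⊆ imagePoints Φ := by
    rintro m Q ⟨a, ha⟩
    exact ⟨∑ l, a l • w l, by rw [ha]; exact funext fun j => eval_restrict Φ _ j a⟩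
  have hmono : ∀ m, imagePoints (Ψ m) ⊆ imagePoints (Ψ (m + 1)) := by
    rintro m Q ⟨a, ha⟩
    refine ⟨Fin.snoc a 0, ?_⟩
    rw [ha]
    funext j
    rw [hΨ]
    simp only [eval_restrict, Fin.sum_univ_castSucc, Fin.snoc_castSucc, Fin.snoc_last, zero_smul,
      add_zero, Fin.val_castSucc]
  have hstrict : ∀ m, m + 1 < r → closure (imagePoints (Ψ (m + 1))) ⊂
      closure (imagePoints (Ψ (m + 2))) := by
    intro m hm
    refine (closure_mono (hmono (m + 1))).ssubset_of_ne fun heq => ?_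
    have hI := congrArg coneIdeal heq
    rw [coneIdeal_closure, coneIdeal_closure] at hI
    obtain ⟨G, hG⟩ := exists_restrict_independent Φ (fun l : Fin (m + 2) => w l) (Pi.single 0 1) (by
      rw [hsum]
      have h1 : LinearIndependent K fun l : Fin (r - 1 + 1) =>
          (u l : Fin (Module.finrank K E) → K) :=
        hu.map' (Submodule.subtype _) (Submodule.ker_subtype _)
      have h2 := h1.comp (Fin.castLE (by omega : m + 2 ≤ r - 1 + 1)) (Fin.castLE_injective _)
      convert h2 using 1
      funext l
      exact hw l (by omega))
    -- The `m + 2` functions `G` are independent on the larger subspace, but satisfy a relation on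
    -- the smaller one, which only has `m + 1` coordinates.
    have hdep := not_algebraicIndependent_of_lt (Nat.lt_succ_self (m + 1))
      fun a => aeval (Ψ (m + 1)) (G a)
    rw [algebraicIndependent_iff] at hdep hG
    push Not at hdep
    obtain ⟨P, hP, hP0⟩ := hdep
    have h1 : aeval G P ∈ coneIdeal (imagePoints (Ψ (m + 1))) := by
      rw [mem_coneIdeal_imagePoints hD (hΨhom _) (hΨ0 _), comp_aeval_apply]
      exact hP
    rw [hI, mem_coneIdeal_imagePoints hD (hΨhom _) (hΨ0 _), comp_aeval_apply] at h1
    exact hP0 (hG P h1)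
  have hXsub : ∀ m, closure (imagePoints (Ψ m)) ⊆ closure (imagePoints Φ) :=
    fun m => closure_mono (hsub m)
  let Z : ℕ → TopologicalSpace.IrreducibleCloseds (closure (imagePoints Φ)) := fun m =>
    ⟨(↑) ⁻¹' closure (imagePoints (Ψ (m + 1))), isIrreducible_preimage_coe (hXsub _)
      (imagePoints_irreducible hD (hΨhom _) (hΨ0 m)).closure,
      isClosed_closure.preimage continuous_subtype_val⟩
  have hZ : ∀ m, m + 1 < r → Z m < Z (m + 1) := by
    intro m hm
    obtain ⟨hle, hne⟩ := hstrict m hm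
    refine ⟨fun x hx => hle hx, fun h => hne fun x hx => ?_⟩
    exact h (show (⟨x, hXsub _ hx⟩ : closure (imagePoints Φ)) ∈ Z (m + 1) from hx)
  exact Order.LTSeries.length_le_krullDim (LTSeries.mk (r - 1) (fun i : Fin (r - 1 + 1) => Z i)
    (Fin.strictMono_iff_lt_succ.2 fun i => hZ i (by omega)))

end ProjectiveDimension

/-! ### Bases of the exterior algebra -/

section ExteriorBasis

open ExteriorAlgebra Module

variable {K : Type*} [Field K] {V : Type*} [AddCommGroup V] [Module K V]
variable {I : Type*} [LinearOrder I] (b : Basis I K V)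

lemma extBasis_mul_of_disjoint {S T : Finset I} (h : Disjoint S T) :
    ∃ ε : ℤˣ, b.ExteriorAlgebra S * b.ExteriorAlgebra T = ε • b.ExteriorAlgebra (S ∪ T) := by
  have := basis_mul_of_disjoint b (⟨S, rfl⟩ : Set.powersetCard I S.card)
    (⟨T, rfl⟩ : Set.powersetCard I T.card) h
  rw [Set.powersetCard.coe_disjUnion, Finset.disjUnion_eq_union] at this
  exact ⟨_, this⟩

lemma extBasis_mul_of_not_disjoint {S T : Finset I} (h : ¬ Disjoint S T) :
    b.ExteriorAlgebra S * b.ExteriorAlgebra T = 0 :=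
  basis_mul_of_not_disjoint b (⟨S, rfl⟩ : Set.powersetCard I S.card)
    (⟨T, rfl⟩ : Set.powersetCard I T.card) h

lemma extBasis_empty : b.ExteriorAlgebra ∅ = 1 := by
  rw [basis_apply_ofCard b (n := 0) Finset.card_empty, ιMulti_family, ιMulti_zero_apply]

lemma extBasis_singleton (i : I) : b.ExteriorAlgebra {i} = ι K (b i) := by
  rw [basis_apply_ofCard b (n := 1) (Finset.card_singleton i), ιMulti_family, ιMulti_succ_apply,
    ιMulti_zero_apply, mul_one]
  congr 2
  obtain ⟨j, hj⟩ := (Set.powersetCard.mem_range_ofFinEmbEquiv_symm_iff_mem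
    (Set.powersetCard.ofCard (Finset.card_singleton i)) i).2 (Finset.mem_singleton_self i)
  rw [Subsingleton.elim 0 j, Function.comp_apply]
  exact congrArg b hj

lemma units_smul_eq (ε : ℤˣ) (x : ExteriorAlgebra K V) : ∃ c : K, c ≠ 0 ∧ ε • x = c • x := by
  rcases Int.units_eq_one_or ε with rfl | rfl
  · exact ⟨1, one_ne_zero, by simp⟩
  · exact ⟨-1, neg_ne_zero.2 one_ne_zero, by simp⟩

/-- The product of basis elements with disjoint index sets is a basis element up to a nonzero
scalar (a sign). -/
lemma exists_extBasis_mul {S T : Finset I} (h : Disjoint S T) :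
    ∃ c : K, c ≠ 0 ∧
      b.ExteriorAlgebra S * b.ExteriorAlgebra T = c • b.ExteriorAlgebra (S ∪ T) := by
  obtain ⟨ε, hε⟩ := extBasis_mul_of_disjoint b h
  obtain ⟨c, hc, h⟩ := units_smul_eq ε (b.ExteriorAlgebra (S ∪ T))
  exact ⟨c, hc, hε.trans h⟩

lemma exists_ιMulti_eq {k : ℕ} {f : Fin k → I} (hf : Function.Injective f) :
    ∃ c : K, c ≠ 0 ∧
      ExteriorAlgebra.ιMulti K k (b ∘ f) = c • b.ExteriorAlgebra (Finset.univ.image f) := by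
  induction k with
  | zero => exact ⟨1, one_ne_zero, by simp [ιMulti_zero_apply, extBasis_empty]⟩
  | succ k ih =>
    obtain ⟨c, hc, h⟩ := ih (f := f ∘ Fin.succ) (hf.comp (Fin.succ_injective _))
    have hdisj : Disjoint {f 0} (Finset.univ.image (f ∘ Fin.succ)) := by
      rw [Finset.disjoint_singleton_left]
      simp [hf.eq_iff, Fin.succ_ne_zero]
    obtain ⟨c', hc', h'⟩ := exists_extBasis_mul b hdisj
    refine ⟨c * c', mul_ne_zero hc hc', ?_⟩
    have hunion : Finset.univ.image f = {f 0} ∪ Finset.univ.image (f ∘ Fin.succ) := by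
      ext x
      simp [Fin.exists_fin_succ, eq_comm]
    rw [ιMulti_succ_apply, hunion, mul_smul, ← h', ← mul_smul_comm, ← h, extBasis_singleton]
    rfl

lemma repr_eq_zero_of_mem {m : ℕ} {y : ExteriorAlgebra K V} (hy : y ∈ ⋀[K]^m V)
    {T : Finset I} (hT : T.card ≠ m) : b.ExteriorAlgebra.repr y T = 0 := by
  have h := (b.exteriorPower m).mem_span (⟨y, hy⟩ : ⋀[K]^m V)
  have h2 := Submodule.mem_map_of_mem (f := (⋀[K]^m V).subtype) h
  have h3 : Submodule.map (⋀[K]^m V).subtype (Submodule.span K (Set.range (b.exteriorPower m))) ≤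
      LinearMap.ker (b.ExteriorAlgebra.coord T) := by
    rw [Submodule.map_span_le]
    rintro _ ⟨S, rfl⟩
    rw [Submodule.subtype_apply, ← basis_eq_coe_basis, LinearMap.mem_ker, Basis.coord_apply,
      Basis.repr_self, Finsupp.single_apply, if_neg]
    rintro rfl
    exact hT S.2
  exact h3 h2

/-- Multiplication by a complementary basis element reads off a coefficient. -/
lemma exists_mul_extBasis_compl [Fintype I] {m : ℕ} {y : ExteriorAlgebra K V} (hy : y ∈ ⋀[K]^m V)
    {S : Finset I} (hS : S.card = m) :
    ∃ c : K, c ≠ 0 ∧ y * b.ExteriorAlgebra Sᶜ =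
      (c * b.ExteriorAlgebra.repr y S) • b.ExteriorAlgebra Finset.univ := by
  obtain ⟨c, hc, h⟩ := exists_extBasis_mul b (disjoint_compl_right (a := S))
  refine ⟨c, hc, ?_⟩
  conv_lhs => rw [← b.ExteriorAlgebra.sum_repr y, Finset.sum_mul]
  rw [Finset.sum_eq_single S]
  · rw [smul_mul_assoc, h, smul_smul, mul_comm, Finset.union_compl]
  · intro T _ hT
    rw [smul_mul_assoc]
    by_cases hTc : T.card = m
    · rw [extBasis_mul_of_not_disjoint, smul_zero]
      rw [disjoint_compl_right_iff]
      exact fun h => hT (Finset.eq_of_subset_of_card_le h (by rw [hS, hTc]))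
    · rw [repr_eq_zero_of_mem b hy hTc, zero_smul]
  · simp

/-- The span of the basis elements `e_S` for which `S` meets `A` in at least `c` elements. -/
def meetSpan (A : Finset I) (c : ℕ) : Submodule K (ExteriorAlgebra K V) :=
  Submodule.span K (b.ExteriorAlgebra '' {S | c ≤ (S ∩ A).card})

lemma extBasis_mem_meetSpan {A : Finset I} {c : ℕ} {S : Finset I} (h : c ≤ (S ∩ A).card) :
    b.ExteriorAlgebra S ∈ meetSpan b A c :=
  Submodule.subset_span ⟨S, h, rfl⟩

lemma mul_mem_meetSpan {A : Finset I} {c d : ℕ} {x y : ExteriorAlgebra K V}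
    (hx : x ∈ meetSpan b A c) (hy : y ∈ meetSpan b A d) : x * y ∈ meetSpan b A (c + d) := by
  have h := Submodule.mul_mem_mul hx hy
  rw [meetSpan, meetSpan, Submodule.span_mul_span] at h
  refine (Submodule.span_le.2 ?_) h
  rintro _ ⟨_, ⟨S, hS, rfl⟩, _, ⟨T, hT, rfl⟩, rfl⟩
  by_cases hST : Disjoint S T
  · obtain ⟨a, -, ha⟩ := exists_extBasis_mul b hST
    change b.ExteriorAlgebra S * b.ExteriorAlgebra T ∈ meetSpan b A (c + d)
    rw [ha]
    refine Submodule.smul_mem _ _ (extBasis_mem_meetSpan b ?_)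
    rw [Finset.union_inter_distrib_right, Finset.card_union_of_disjoint
      (hST.mono Finset.inter_subset_left Finset.inter_subset_left)]
    exact add_le_add hS hT
  · change b.ExteriorAlgebra S * b.ExteriorAlgebra T ∈ meetSpan b A (c + d)
    rw [extBasis_mul_of_not_disjoint b hST]
    exact zero_mem _

lemma meetSpan_zero (A : Finset I) : meetSpan b A 0 = ⊤ := by
  rw [meetSpan, ← b.ExteriorAlgebra.span_eq]
  congr
  ext
  simp

lemma meetSpan_eq_bot {A : Finset I} {c : ℕ} (h : A.card < c) : meetSpan b A c = ⊥ := by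
  rw [meetSpan, Submodule.span_eq_bot]
  rintro _ ⟨S, hS, rfl⟩
  have := Finset.card_le_card (Finset.inter_subset_right (s₁ := S) (s₂ := A))
  exact absurd (hS.trans this) (by omega)

variable {k : ℕ} {e : Fin k → I}

lemma idealOf_le_meetSpan {x : ExteriorAlgebra K V} (hx : x ∈ idealOf K (b ∘ e)) :
    x ∈ meetSpan b (Finset.univ.image e) 1 := by
  set A := Finset.univ.image e
  set J : TwoSidedIdeal (ExteriorAlgebra K V) := TwoSidedIdeal.mk' (meetSpan b A 1) (zero_mem _)
    (fun hx hy => add_mem hx hy) (fun hx => neg_mem hx)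
    (fun {x y} hy => by
      have := mul_mem_meetSpan b (c := 0) (x := x) (by rw [meetSpan_zero]; trivial) hy
      rwa [zero_add] at this)
    (fun {x y} hx => mul_mem_meetSpan b (d := 0) hx (by rw [meetSpan_zero]; trivial)) with hJ
  have hle : TwoSidedIdeal.span (Set.range fun i => ι K ((b ∘ e) i)) ≤ J := by
    rw [TwoSidedIdeal.span_le]
    rintro _ ⟨i, rfl⟩
    change ι K (b (e i)) ∈ J
    rw [hJ, TwoSidedIdeal.mem_mk', ← extBasis_singleton]
    refine extBasis_mem_meetSpan b ?_
    rw [Finset.singleton_inter_of_mem (Finset.mem_image_of_mem e (Finset.mem_univ i))]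
    simp
  have := hle (TwoSidedIdeal.mem_asIdeal.1 hx)
  rwa [hJ, TwoSidedIdeal.mem_mk'] at this

lemma idealOf_mul_le_meetSpan {x : ExteriorAlgebra K V}
    (hx : x ∈ idealOf K (b ∘ e) * idealOf K (b ∘ e)) :
    x ∈ meetSpan b (Finset.univ.image e) 2 := by
  let J : Ideal (ExteriorAlgebra K V) :=
    { carrier := meetSpan b (Finset.univ.image e) 2
      add_mem' := fun hx hy => add_mem hx hy
      zero_mem' := zero_mem _
      smul_mem' := fun r x hx => by
        have := mul_mem_meetSpan b (c := 0) (x := r) (by rw [meetSpan_zero]; trivial) hx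
        rw [zero_add] at this
        rw [smul_eq_mul]
        exact this }
  have hJ : ∀ x, x ∈ J ↔ x ∈ meetSpan b (Finset.univ.image e) 2 := fun _ => Iff.rfl
  have hle : idealOf K (b ∘ e) * idealOf K (b ∘ e) ≤ J := by
    rw [Ideal.mul_le]
    intro r hr s hs
    rw [hJ]
    exact mul_mem_meetSpan b (c := 1) (d := 1) (idealOf_le_meetSpan b hr)
      (idealOf_le_meetSpan b hs)
  exact (hJ x).1 (hle hx)

lemma extBasis_mem_idealOf_mul {S : Finset I} (hS : 2 ≤ (S ∩ Finset.univ.image e).card) :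
    b.ExteriorAlgebra S ∈ idealOf K (b ∘ e) * idealOf K (b ∘ e) := by
  obtain ⟨x, hx, y, hy, hxy⟩ := Finset.one_lt_card.1 hS
  simp only [Finset.mem_inter, Finset.mem_image, Finset.mem_univ, true_and] at hx hy
  obtain ⟨hxS, i, rfl⟩ := hx
  obtain ⟨hyS, j, rfl⟩ := hy
  have hgen : ∀ i, b.ExteriorAlgebra {e i} ∈
      TwoSidedIdeal.span (Set.range fun i => ι K ((b ∘ e) i)) := fun i => by
    rw [extBasis_singleton]
    exact TwoSidedIdeal.subset_span ⟨i, rfl⟩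
  set R := (S.erase (e i)).erase (e j) with hR
  obtain ⟨c, hc, h⟩ := exists_extBasis_mul b (S := {e j}) (T := R) (by simp [hR])
  obtain ⟨c', hc', h'⟩ := exists_extBasis_mul b (S := {e i}) (T := {e j} ∪ R)
    (by simp [hR, hxy])
  have hunion : {e i} ∪ ({e j} ∪ R) = S := by
    ext z
    simp only [hR, Finset.mem_union, Finset.mem_singleton, Finset.mem_erase]
    grind
  have hmem : b.ExteriorAlgebra {e i} * (b.ExteriorAlgebra {e j} * b.ExteriorAlgebra R) ∈
      idealOf K (b ∘ e) * idealOf K (b ∘ e) :=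
    Ideal.mul_mem_mul (TwoSidedIdeal.mem_asIdeal.2 (hgen i))
      (TwoSidedIdeal.mem_asIdeal.2 (TwoSidedIdeal.mul_mem_right _ _ _ (hgen j)))
  rw [h, mul_smul_comm, h', hunion, smul_smul] at hmem
  have := Submodule.smul_of_tower_mem _ (c * c')⁻¹ hmem
  rwa [smul_smul, inv_mul_cancel₀ (mul_ne_zero hc hc'), one_smul] at this

end ExteriorBasis

/-! ### Orthogonality of tangent spaces and squares of ideals -/

section Tangent

open ExteriorAlgebra Module

variable (K : Type*) [Field K] {V : Type*} [AddCommGroup V] [Module K V]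

/-- The affine tangent space to the cone over the Grassmannian at `v₁ ∧ ⋯ ∧ v_k`: it is spanned by
this vector and by the products with one of the factors replaced by an arbitrary vector. (The first
generator is only needed for `k = 0`.) -/
def tangentSpan {k : ℕ} (v : Fin k → V) : Submodule K (⋀[K]^k V) :=
  Submodule.span K ({exteriorPower.ιMulti K k v} ∪
    Set.range fun p : Fin k × V => exteriorPower.ιMulti K k (Function.update v p.1 p.2))

variable {K}

/-- An independent family is part of a basis. -/
lemma exists_adapted_basis [FiniteDimensional K V] {N k : ℕ} (hV : finrank K V = N) {v : Fin k → V}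
    (hv : LinearIndependent K v) :
    ∃ (b : Basis (Fin N) K V) (e : Fin k → Fin N), Function.Injective e ∧ v = b ∘ e := by
  let b₀ := Basis.extend hv.linearIndepOn_id
  let _ := FiniteDimensional.fintypeBasisIndex b₀
  let φ := Fintype.equivFinOfCardEq ((finrank_eq_card_basis b₀).symm.trans hV)
  have hmem : ∀ i, v i ∈ hv.linearIndepOn_id.extend (Set.subset_univ _) := fun i =>
    Basis.subset_extend hv.linearIndepOn_id ⟨i, rfl⟩
  refine ⟨b₀.reindex φ, fun i => φ ⟨v i, hmem i⟩, fun i j hij => ?_, ?_⟩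
  · exact hv.injective (congrArg Subtype.val (φ.injective hij))
  · funext i
    simp [b₀]

/-- The degree `m` part of the square of the ideal is the orthogonal of the tangent space: in a
basis containing the `v i`, both consist of the combinations of basis elements `e_S` for which `S`
contains at least two of the indices of the `v i`. -/
theorem mem_idealOf_sq_iff [FiniteDimensional K V] {m k : ℕ} (hV : finrank K V = m + k)
    {v : Fin k → V} (hv : LinearIndependent K v) {y : ExteriorAlgebra K V} (hy : y ∈ ⋀[K]^m V) :
    y ∈ idealOf K v * idealOf K v ↔ ∀ w ∈ tangentSpan K v, y * (w : ExteriorAlgebra K V) = 0 := by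
  obtain ⟨b, e, he, rfl⟩ := exists_adapted_basis hV hv
  set A := Finset.univ.image e with hA
  have hAcard : A.card = k := by rw [hA, Finset.card_image_of_injective _ he]; simp
  constructor
  · -- `y` lies in the span of the `e_S` meeting `A` twice, and `w` in the span of those meeting it
    -- `k - 1` times (truncated, so `0` for `k = 0`), so the product vanishes as `2 + (k - 1) > k`.
    intro hyI w hw
    have hy2 := idealOf_mul_le_meetSpan b hyI
    have hw' : (w : ExteriorAlgebra K V) ∈ meetSpan b A (k - 1) := by
      have hle : tangentSpan K (b ∘ e) ≤
          (meetSpan b A (k - 1)).comap (⋀[K]^k V).subtype := by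
        rw [tangentSpan, Submodule.span_le]
        rintro _ (rfl | ⟨⟨i, x⟩, rfl⟩)
        · obtain ⟨c, -, h⟩ := exists_ιMulti_eq b he
          change ExteriorAlgebra.ιMulti K k (b ∘ e) ∈ meetSpan b A (k - 1)
          rw [h]
          refine Submodule.smul_mem _ _ (extBasis_mem_meetSpan b ?_)
          rw [Finset.inter_self, hAcard]
          omega
        · change ExteriorAlgebra.ιMulti K k (Function.update (b ∘ e) i x) ∈ meetSpan b A (k - 1)
          rw [← b.sum_repr x, AlternatingMap.map_update_sum]
          refine Submodule.sum_mem _ fun a _ => ?_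
          rw [AlternatingMap.map_update_smul]
          refine Submodule.smul_mem _ _ ?_
          rw [← Function.comp_update]
          by_cases hinj : Function.Injective (Function.update e i a)
          · obtain ⟨c, -, h⟩ := exists_ιMulti_eq b hinj
            rw [h]
            refine Submodule.smul_mem _ _ (extBasis_mem_meetSpan b ?_)
            have hsub : A.erase (e i) ⊆ Finset.univ.image (Function.update e i a) ∩ A := by
              intro z hz
              obtain ⟨hz1, hz2⟩ := Finset.mem_erase.1 hz
              refine Finset.mem_inter.2 ⟨?_, hz2⟩
              obtain ⟨j, -, rfl⟩ := Finset.mem_image.1 hz2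
              refine Finset.mem_image.2 ⟨j, Finset.mem_univ j, ?_⟩
              rw [Function.update_of_ne]
              rintro rfl
              exact hz1 rfl
            refine le_trans ?_ (Finset.card_le_card hsub)
            rw [Finset.card_erase_of_mem (Finset.mem_image_of_mem e (Finset.mem_univ i)), hAcard]
          · rw [ιMulti_eq_zero_of_not_inj]
            · exact zero_mem _
            · exact fun h => hinj h.of_comp
      exact hle hw
    have := mul_mem_meetSpan b hy2 hw'
    rwa [meetSpan_eq_bot b (by rw [hAcard]; omega), Submodule.mem_bot] at this
  · -- A coefficient of `y` at a set `S` meeting `A` at most once is read off by multiplying with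
    -- `e_{Sᶜ}`, which is tangent.
    intro h
    rw [← b.ExteriorAlgebra.sum_repr y]
    refine Submodule.sum_mem _ fun S _ => ?_
    by_cases hS2 : 2 ≤ (S ∩ A).card
    · exact Submodule.smul_of_tower_mem _ _ (extBasis_mem_idealOf_mul b hS2)
    suffices b.ExteriorAlgebra.repr y S = 0 by rw [this, zero_smul]; exact zero_mem _
    by_cases hSm : S.card = m
    swap
    · exact repr_eq_zero_of_mem b hy hSm
    obtain ⟨c, hc, hcS⟩ := exists_mul_extBasis_compl b hy hSm
    suffices h0 : y * b.ExteriorAlgebra Sᶜ = 0 by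
      rw [h0, eq_comm, smul_eq_zero] at hcS
      exact (mul_eq_zero.1 (hcS.resolve_right (b.ExteriorAlgebra.ne_zero _))).resolve_left hc
    have hScard : Sᶜ.card = k := by rw [Finset.card_compl, Fintype.card_fin]; omega
    -- The complement of `S` is obtained from `A` by replacing at most one element.
    suffices ∃ c : K, c ≠ 0 ∧ ∃ w ∈ tangentSpan K (b ∘ e),
        (w : ExteriorAlgebra K V) = c • b.ExteriorAlgebra Sᶜ by
      obtain ⟨c, hc, w, hw, hwc⟩ := this
      have := h w hw
      rw [hwc, mul_smul_comm, smul_eq_zero] at this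
      exact this.resolve_left hc
    rcases Nat.lt_or_ge 0 (S ∩ A).card with hpos | hzero
    · obtain ⟨z, hz⟩ := Finset.card_eq_one.1 (by omega : (S ∩ A).card = 1)
      have hzmem : z ∈ S ∩ A := hz ▸ Finset.mem_singleton_self z
      obtain ⟨hzS, hzA⟩ := Finset.mem_inter.1 hzmem
      obtain ⟨i, -, rfl⟩ := Finset.mem_image.1 hzA
      have herase : A.erase (e i) ⊆ Sᶜ := by
        intro x hx
        obtain ⟨hx1, hx2⟩ := Finset.mem_erase.1 hx
        rw [Finset.mem_compl]
        intro hxS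
        have : x ∈ S ∩ A := Finset.mem_inter.2 ⟨hxS, hx2⟩
        rw [hz, Finset.mem_singleton] at this
        exact hx1 this
      have hcardpos : 0 < k := hAcard ▸ Finset.card_pos.2 ⟨_, hzA⟩
      have hdiff : (Sᶜ \ A.erase (e i)).card = 1 := by
        rw [Finset.card_sdiff_of_subset herase, Finset.card_erase_of_mem hzA, hAcard, hScard]
        omega
      obtain ⟨a, ha⟩ := Finset.card_eq_one.1 hdiff
      have haS : a ∈ Sᶜ \ A.erase (e i) := ha ▸ Finset.mem_singleton_self a
      have haA : a ∉ A.erase (e i) := (Finset.mem_sdiff.1 haS).2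
      have hane : a ≠ e i := by
        rintro rfl
        exact Finset.mem_compl.1 (Finset.mem_sdiff.1 haS).1 hzS
      have haA' : ∀ j, e j ≠ a := by
        rintro j rfl
        exact haA (Finset.mem_erase.2 ⟨hane, Finset.mem_image_of_mem e (Finset.mem_univ j)⟩)
      have hinj : Function.Injective (Function.update e i a) :=
        by
        intro j j' hjj
        by_cases hj : j = i <;> by_cases hj' : j' = i
        · rw [hj, hj']
        · rw [hj, Function.update_self, Function.update_of_ne hj'] at hjj
          exact absurd hjj.symm (haA' j')
        · rw [hj', Function.update_self, Function.update_of_ne hj] at hjj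
          exact absurd hjj (haA' j)
        · rw [Function.update_of_ne hj, Function.update_of_ne hj'] at hjj
          exact he hjj
      obtain ⟨c, hc, hcw⟩ := exists_ιMulti_eq b hinj
      refine ⟨c, hc, exteriorPower.ιMulti K k (Function.update (b ∘ e) i (b a)),
        Submodule.subset_span (Or.inr ⟨(i, b a), rfl⟩), ?_⟩
      rw [exteriorPower.ιMulti_apply_coe, ← Function.comp_update, hcw]
      congr 2
      refine Finset.eq_of_subset_of_card_le (fun x hx => ?_)
        (by rw [hScard, Finset.card_image_of_injective _ hinj, Finset.card_univ, Fintype.card_fin])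
      obtain ⟨j, -, rfl⟩ := Finset.mem_image.1 hx
      by_cases hj : j = i
      · rw [hj, Function.update_self]
        exact (Finset.mem_sdiff.1 haS).1
      · rw [Function.update_of_ne hj]
        exact herase (Finset.mem_erase.2
          ⟨fun h => hj (he h), Finset.mem_image_of_mem e (Finset.mem_univ j)⟩)
    · obtain ⟨c, hc, hcw⟩ := exists_ιMulti_eq b he
      refine ⟨c, hc, exteriorPower.ιMulti K k (b ∘ e), Submodule.subset_span (Or.inl rfl), ?_⟩
      rw [exteriorPower.ιMulti_apply_coe, hcw]
      congr 2
      refine Finset.eq_of_subset_of_card_le (fun x hx => ?_) (by rw [hAcard, hScard])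
      rw [Finset.mem_compl]
      intro hxS
      have : 0 < (S ∩ A).card := Finset.card_pos.2 ⟨x, Finset.mem_inter.2 ⟨hxS, hx⟩⟩
      omega

/-- The pairing `⋀ᵐ V × ⋀ᵏ V → K` given by the top coefficient of the product. -/
def topPairing {N : ℕ} (b : Basis (Fin N) K V) (m k : ℕ) : ⋀[K]^m V →ₗ[K] Dual K (⋀[K]^k V) :=
  LinearMap.mk₂ K (fun y w => b.ExteriorAlgebra.coord Finset.univ ((y : ExteriorAlgebra K V) * w))
    (fun _ _ _ => by simp [add_mul]) (fun _ _ _ => by simp)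
    (fun _ _ _ => by simp [mul_add]) (fun _ _ _ => by simp)

lemma topPairing_apply {N : ℕ} (b : Basis (Fin N) K V) {m k : ℕ} (y : ⋀[K]^m V) (w : ⋀[K]^k V) :
    topPairing b m k y w =
      b.ExteriorAlgebra.coord Finset.univ ((y : ExteriorAlgebra K V) * w) := rfl

lemma topPairing_eq_zero_iff {m k : ℕ} (b : Basis (Fin (m + k)) K V) (y : ⋀[K]^m V)
    (w : ⋀[K]^k V) :
    topPairing b m k y w = 0 ↔ (y : ExteriorAlgebra K V) * (w : ExteriorAlgebra K V) = 0 := by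
  rw [topPairing_apply]
  refine ⟨fun h => ?_, fun h => by rw [h, map_zero]⟩
  have hmem : (y : ExteriorAlgebra K V) * (w : ExteriorAlgebra K V) ∈ ⋀[K]^(m + k) V :=
    SetLike.mul_mem_graded y.2 w.2
  refine b.ExteriorAlgebra.ext_elem fun S => ?_
  rw [map_zero, Finsupp.zero_apply]
  by_cases hS : S.card = m + k
  · rw [Finset.eq_univ_of_card S (by rw [hS, Fintype.card_fin])]
    exact h
  · exact repr_eq_zero_of_mem b hmem hS

lemma topPairing_injective {m k : ℕ} (b : Basis (Fin (m + k)) K V) :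
    Function.Injective (topPairing b m k) := by
  rw [injective_iff_map_eq_zero]
  intro y hy
  refine Subtype.ext (b.ExteriorAlgebra.ext_elem fun S => ?_)
  rw [ZeroMemClass.coe_zero, map_zero, Finsupp.zero_apply]
  by_cases hS : S.card = m
  swap
  · exact repr_eq_zero_of_mem b y.2 hS
  obtain ⟨c, hc, h⟩ := exists_mul_extBasis_compl b y.2 hS
  have hmem : b.ExteriorAlgebra Sᶜ ∈ ⋀[K]^k V := by
    have hcard : Sᶜ.card = k := by rw [Finset.card_compl, Fintype.card_fin]; omega
    rw [basis_eq_coe_basis b (⟨Sᶜ, hcard⟩ : Set.powersetCard (Fin (m + k)) k)]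
    exact SetLike.coe_mem _
  have h1 := (topPairing_eq_zero_iff b y ⟨_, hmem⟩).1 (by rw [hy]; rfl)
  rw [h, smul_eq_zero] at h1
  exact (mul_eq_zero.1 (h1.resolve_right (b.ExteriorAlgebra.ne_zero _))).resolve_left hc

/-- The degree `m` part of the intersection of the squares of the ideals is the orthogonal of the
sum of the tangent spaces, under the perfect pairing of complementary degrees. -/
theorem finrank_fatPiece_perp [FiniteDimensional K V] {m k s : ℕ} (hV : finrank K V = m + k)
    {v : Fin s → Fin k → V} (hv : ∀ j, LinearIndependent K (v j)) :
    finrank K (perp K k (fatPiece K v m)) = finrank K (⨆ j, tangentSpan K (v j) : Submodule K _) ∧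
    finrank K (fatPiece K v m) + finrank K (⨆ j, tangentSpan K (v j) : Submodule K _) =
      (m + k).choose k := by
  set T : Submodule K (⋀[K]^k V) := ⨆ j, tangentSpan K (v j) with hT
  let b := finBasisOfFinrankEq K V hV
  have hrank : finrank K (⋀[K]^m V) = finrank K (Dual K (⋀[K]^k V)) := by
    rw [Subspace.dual_finrank_eq, exteriorPower.finrank_eq, exteriorPower.finrank_eq, hV,
      Nat.choose_symm_add]
  let B := LinearMap.linearEquivOfInjective (topPairing b m k) (topPairing_injective b) hrank
  have hB : ∀ y w, B y w = topPairing b m k y w := fun y w => rfl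
  have hmem : ∀ y : ⋀[K]^m V, (y : ExteriorAlgebra K V) ∈ fatPiece K v m ↔
      B y ∈ T.dualAnnihilator := by
    intro y
    have h1 : (y : ExteriorAlgebra K V) ∈ fatPiece K v m ↔
        ∀ j, (y : ExteriorAlgebra K V) ∈ idealOf K (v j) * idealOf K (v j) := by
      rw [fatPiece, Submodule.mem_inf, Submodule.restrictScalars_mem, Submodule.mem_iInf]
      exact ⟨fun h => h.1, fun h => ⟨h, y.2⟩⟩
    rw [h1, Submodule.mem_dualAnnihilator]
    constructor
    · intro h w hw
      have hle : T ≤ LinearMap.ker (B y) := iSup_le fun j w hw => by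
        rw [LinearMap.mem_ker, hB, topPairing_eq_zero_iff]
        exact (mem_idealOf_sq_iff hV (hv j) y.2).1 (h j) w hw
      exact hle hw
    · intro h j
      rw [mem_idealOf_sq_iff hV (hv j) y.2]
      intro w hw
      rw [← topPairing_eq_zero_iff b, ← hB]
      exact h w (Submodule.mem_iSup_of_mem j hw)
  have hfat : fatPiece K v m =
      (T.dualAnnihilator.map B.symm.toLinearMap).map (⋀[K]^m V).subtype := by
    ext y
    constructor
    · intro hy
      have hym : y ∈ ⋀[K]^m V := hy.2
      exact ⟨⟨y, hym⟩, ⟨B ⟨y, hym⟩, (hmem ⟨y, hym⟩).1 hy, B.symm_apply_apply _⟩, rfl⟩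
    · rintro ⟨_, ⟨φ, hφ, rfl⟩, rfl⟩
      refine (hmem _).2 ?_
      change B (B.symm φ) ∈ _
      rwa [LinearEquiv.apply_symm_apply]
  have hperp : perp K k (fatPiece K v m) = T.map (⋀[K]^k V).subtype := by
    ext w
    constructor
    · rintro ⟨hwk, hw⟩
      refine ⟨⟨w, hwk⟩, ?_, rfl⟩
      change _ ∈ T
      rw [← Subspace.dualAnnihilator_dualCoannihilator_eq (W := T), Submodule.mem_dualCoannihilator]
      intro φ hφ
      rw [← B.apply_symm_apply φ] at hφ ⊢
      rw [hB, topPairing_eq_zero_iff]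
      exact hw _ ((hmem _).2 hφ)
    · rintro ⟨w, hw, rfl⟩
      refine ⟨w.2, fun y hy => ?_⟩
      have h1 := (hmem ⟨y, hy.2⟩).1 hy
      rw [Submodule.mem_dualAnnihilator] at h1
      exact (topPairing_eq_zero_iff b ⟨y, hy.2⟩ w).1 (h1 w hw)
  have hfin : finrank K (fatPiece K v m) = finrank K T.dualAnnihilator := by
    rw [hfat, Submodule.finrank_map_subtype_eq,
      LinearEquiv.finrank_map_eq B.symm]
  constructor
  · rw [hperp, Submodule.finrank_map_subtype_eq]
  · rw [hfin, add_comm, Subspace.finrank_add_finrank_dualAnnihilator_eq, exteriorPower.finrank_eq,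
      hV]

end Tangent

/-! ### The parametrisation of the secant variety -/

section SecantParametrisation

open MvPolynomial Module

attribute [local instance] zariskiTopology

variable {K : Type*} [Field K] {V : Type*} [AddCommGroup V] [Module K V]
variable {N : ℕ} (b : Basis (Fin N) K V) (s k : ℕ)

/-- The index type of the parameters of the secant variety: `s` scalars, and the coordinates of
`s` families of `k` vectors. -/
abbrev ParamIndex (N s k : ℕ) : Type := Fin s ⊕ (Fin s × Fin k × Fin N)

variable {s k}

/-- The families of vectors described by a parameter. -/
def vectorsOf (x : ParamIndex N s k → K) (a : Fin s) (i : Fin k) : V :=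
  ∑ l, x (Sum.inr (a, i, l)) • b l

/-- The parameter describing given scalars and families of vectors. -/
def paramOf (t : Fin s → K) (v : Fin s → Fin k → V) : ParamIndex N s k → K :=
  Sum.elim t fun p => b.repr (v p.1 p.2.1) p.2.2

lemma vectorsOf_paramOf (t : Fin s → K) (v : Fin s → Fin k → V) :
    vectorsOf b (paramOf b t v) = v := by
  funext a i
  exact b.sum_repr (v a i)

lemma paramOf_vectorsOf (x : ParamIndex N s k → K) :
    paramOf b (x ∘ Sum.inl) (vectorsOf b x) = x := by
  funext p
  rcases p with a | ⟨a, i, l⟩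
  · rfl
  · simp [paramOf, vectorsOf, Finsupp.single_apply]

lemma linearIndependent_of_ιMulti_ne_zero {v : Fin k → V}
    (hv : exteriorPower.ιMulti K k v ≠ 0) : LinearIndependent K v := by
  by_contra h
  exact hv (AlternatingMap.map_linearDependent _ v h)

variable [FiniteDimensional K V]

/-- The coordinates of `v_{a,1} ∧ ⋯ ∧ v_{a,k}` as polynomials in the coordinates of the vectors. -/
def wedgePoly (a : Fin s) (j : Fin (finrank K (⋀[K]^k V))) : MvPolynomial (ParamIndex N s k) K :=
  ∑ f : Fin k → Fin N, C (coords K _ (exteriorPower.ιMulti K k (b ∘ f)) j) *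
    ∏ i, X (Sum.inr (a, i, f i))

/-- The coordinates of `∑ t_a v_{a,1} ∧ ⋯ ∧ v_{a,k}` as polynomials in the parameters. -/
def secantPoly (s : ℕ) (j : Fin (finrank K (⋀[K]^k V))) : MvPolynomial (ParamIndex N s k) K :=
  ∑ a : Fin s, X (Sum.inl a) * wedgePoly b a j

lemma coords_ιMulti_sum (c : Fin k → Fin N → K) (j : Fin (finrank K (⋀[K]^k V))) :
    coords K _ (exteriorPower.ιMulti K k fun i => ∑ l, c i l • b l) j =
      ∑ f : Fin k → Fin N, coords K _ (exteriorPower.ιMulti K k (b ∘ f)) j * ∏ i, c i (f i) := by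
  have h := (exteriorPower.ιMulti K k (M := V)).toMultilinearMap.map_sum
    (fun i (l : Fin N) => c i l • b l)
  have h' : exteriorPower.ιMulti K k (fun i => ∑ l, c i l • b l) =
      ∑ f : Fin k → Fin N, (∏ i, c i (f i)) • exteriorPower.ιMulti K k (b ∘ f) := by
    refine h.trans (Finset.sum_congr rfl fun f _ => ?_)
    exact (exteriorPower.ιMulti K k (M := V)).toMultilinearMap.map_smul_univ
      (fun i => c i (f i)) (fun i => b (f i))
  rw [h', map_sum, Finset.sum_apply]
  exact Finset.sum_congr rfl fun f _ => by rw [map_smul, Pi.smul_apply, smul_eq_mul, mul_comm]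

lemma eval_wedgePoly (a : Fin s) (j : Fin (finrank K (⋀[K]^k V))) (x : ParamIndex N s k → K) :
    eval x (wedgePoly b a j) = coords K _ (exteriorPower.ιMulti K k (vectorsOf b x a)) j := by
  refine Eq.trans ?_ (coords_ιMulti_sum b (fun i l => x (Sum.inr (a, i, l))) j).symm
  simp [wedgePoly, map_sum, map_prod]

lemma eval_secantPoly (j : Fin (finrank K (⋀[K]^k V))) (x : ParamIndex N s k → K) :
    eval x (secantPoly b s j) =
      coords K _ (∑ a, x (Sum.inl a) • exteriorPower.ιMulti K k (vectorsOf b x a)) j := by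
  simp [secantPoly, map_sum, eval_wedgePoly, Finset.sum_apply]

lemma secantPoly_isHomogeneous (s : ℕ) (j : Fin (finrank K (⋀[K]^k V))) :
    (secantPoly b s j).IsHomogeneous (1 + k) := by
  refine IsHomogeneous.sum _ _ _ fun a _ => (isHomogeneous_X K _).mul ?_
  refine IsHomogeneous.sum _ _ _ fun f _ => ?_
  have h := (isHomogeneous_C (ParamIndex N s k)
    (coords K _ (exteriorPower.ιMulti K k (b ∘ f)) j)).mul
    (IsHomogeneous.prod Finset.univ (fun i : Fin k => (X (Sum.inr (a, i, f i)) :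
      MvPolynomial (ParamIndex N s k) K)) (fun _ => 1) fun i _ => isHomogeneous_X K _)
  simpa using h

lemma eval_dirDeriv_prod_X {σ ι : Type*} [DecidableEq ι] (x w : σ → K) (S : Finset ι) (g : ι → σ) :
    eval x (dirDeriv w (∏ i ∈ S, X (g i))) = ∑ i ∈ S, w (g i) * ∏ i' ∈ S.erase i, x (g i') := by
  induction S using Finset.induction_on with
  | empty => simp
  | insert a S ha ih =>
    rw [Finset.prod_insert ha, Derivation.leibniz, Finset.sum_insert ha, Finset.erase_insert ha]
    simp only [smul_eq_mul, map_add, map_mul, eval_X, ih, map_prod]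
    have h1 : eval x (dirDeriv w (X (g a))) = w (g a) := by simp [dirDeriv, mkDerivation_X]
    rw [h1, Finset.mul_sum, add_comm, mul_comm]
    congr 1
    refine Finset.sum_congr rfl fun i hi => ?_
    rw [Finset.erase_insert_of_ne (by rintro rfl; exact ha hi), Finset.prod_insert
      (fun h => ha (Finset.mem_of_mem_erase h))]
    ring

lemma eval_dirDeriv_wedgePoly (a : Fin s) (j : Fin (finrank K (⋀[K]^k V)))
    (x w : ParamIndex N s k → K) :
    eval x (dirDeriv w (wedgePoly b a j)) = coords K _ (∑ i, exteriorPower.ιMulti K k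
      (Function.update (vectorsOf b x a) i (vectorsOf b w a i))) j := by
  rw [map_sum, Finset.sum_apply]
  have h : ∀ i, coords K _ (exteriorPower.ιMulti K k
      (Function.update (vectorsOf b x a) i (vectorsOf b w a i))) j =
      ∑ f : Fin k → Fin N, coords K _ (exteriorPower.ιMulti K k (b ∘ f)) j *
        (w (Sum.inr (a, i, f i)) * ∏ i' ∈ Finset.univ.erase i, x (Sum.inr (a, i', f i'))) := by
    intro i
    have h1 : Function.update (vectorsOf b x a) i (vectorsOf b w a i) = fun i' => ∑ l,
        (Function.update (fun i' l => x (Sum.inr (a, i', l))) i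
          (fun l => w (Sum.inr (a, i, l))) i' l) • b l := by
      funext i'
      by_cases hi : i' = i
      · subst hi
        simp [vectorsOf]
      · simp [Function.update_of_ne hi, vectorsOf]
    rw [h1, coords_ιMulti_sum]
    refine Finset.sum_congr rfl fun f _ => ?_
    rw [← Finset.mul_prod_erase _ _ (Finset.mem_univ i), Function.update_self]
    congr 2
    refine Finset.prod_congr rfl fun i' hi' => ?_
    rw [Function.update_of_ne (Finset.ne_of_mem_erase hi')]
  rw [Finset.sum_congr rfl fun i _ => h i, Finset.sum_comm, wedgePoly, map_sum, map_sum]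
  refine Finset.sum_congr rfl fun f _ => ?_
  rw [Derivation.leibniz, ← algebraMap_eq, Derivation.map_algebraMap, smul_zero, add_zero,
    algebraMap_eq, smul_eq_mul, map_mul, eval_C, eval_dirDeriv_prod_X, Finset.mul_sum]

lemma differential_secantPoly (x w : ParamIndex N s k → K) :
    differential (secantPoly b s (k := k)) x w = coords K _ (∑ a,
      (w (Sum.inl a) • exteriorPower.ιMulti K k (vectorsOf b x a) +
        x (Sum.inl a) • ∑ i, exteriorPower.ιMulti K k
          (Function.update (vectorsOf b x a) i (vectorsOf b w a i)))) := by
  funext j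
  rw [differential_apply, secantPoly, map_sum, map_sum, map_sum, Finset.sum_apply]
  refine Finset.sum_congr rfl fun a _ => ?_
  rw [Derivation.leibniz, map_add, smul_eq_mul, smul_eq_mul, map_mul, map_mul, eval_X,
    eval_dirDeriv_wedgePoly, eval_wedgePoly]
  have h1 : eval x (dirDeriv w (X (Sum.inl a))) = w (Sum.inl a) := by
    simp [dirDeriv, mkDerivation_X]
  rw [h1, map_add, Pi.add_apply, map_smul, map_smul, Pi.smul_apply, Pi.smul_apply, smul_eq_mul,
    smul_eq_mul, add_comm]
  ring

/-- Terracini's lemma in coordinates: where all the scalars are nonzero, the image of the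
differential is the sum of the tangent spaces. -/
lemma range_differential_secantPoly {x : ParamIndex N s k → K} (hx : ∀ a, x (Sum.inl a) ≠ 0) :
    LinearMap.range (differential (secantPoly b s (k := k)) x) =
      (⨆ a, tangentSpan K (vectorsOf b x a)).map (coords K (⋀[K]^k V)).toLinearMap := by
  apply le_antisymm
  · rintro _ ⟨w, rfl⟩
    rw [differential_secantPoly]
    refine Submodule.mem_map_of_mem (Submodule.sum_mem _ fun a _ => ?_)
    refine Submodule.mem_iSup_of_mem a (add_mem (Submodule.smul_mem _ _ ?_)
      (Submodule.smul_mem _ _ (Submodule.sum_mem _ fun i _ => ?_)))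
    · exact Submodule.subset_span (Or.inl rfl)
    · exact Submodule.subset_span (Or.inr ⟨(i, _), rfl⟩)
  · rw [Submodule.map_le_iff_le_comap]
    refine iSup_le fun a => ?_
    rw [tangentSpan, Submodule.span_le]
    have hzero : ∀ (a' : Fin s) (i' : Fin k), vectorsOf b (0 : ParamIndex N s k → K) a' i' = 0 :=
      fun a' i' => by simp [vectorsOf]
    rintro _ (rfl | ⟨⟨i, u⟩, rfl⟩)
    · refine ⟨paramOf b (Pi.single a 1) 0, ?_⟩
      rw [differential_secantPoly, vectorsOf_paramOf]
      change coords K _ _ = coords K _ _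
      congr 1
      rw [Finset.sum_eq_single a]
      · simp [paramOf, AlternatingMap.map_update_zero]
      · intro a' _ ha'
        simp [paramOf, AlternatingMap.map_update_zero, ha']
      · simp
    · refine ⟨paramOf b 0 (Pi.single a (Pi.single i ((x (Sum.inl a))⁻¹ • u))), ?_⟩
      rw [differential_secantPoly, vectorsOf_paramOf]
      change coords K _ _ = coords K _ _
      congr 1
      rw [Finset.sum_eq_single a]
      · rw [Finset.sum_eq_single i]
        · simp [paramOf, AlternatingMap.map_update_smul, smul_smul, hx a]
        · intro i' _ hi'
          simp [hi', AlternatingMap.map_update_zero]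
        · simp
      · intro a' _ ha'
        simp [paramOf, AlternatingMap.map_update_zero, ha']
      · simp

lemma ιMulti_ne_zero {v : Fin k → V} (hv : LinearIndependent K v) :
    exteriorPower.ιMulti K k v ≠ 0 := by
  obtain ⟨b', e, he, rfl⟩ := exists_adapted_basis rfl hv
  obtain ⟨c, hc, h⟩ := exists_ιMulti_eq b' he
  intro h0
  have := congrArg Subtype.val h0
  rw [exteriorPower.ιMulti_apply_coe, h, ZeroMemClass.coe_zero, smul_eq_zero] at this
  exact this.elim hc (b'.ExteriorAlgebra.ne_zero _)

/-- The union of the spans of `s` points of the Grassmannian is the image of the parametrisation. -/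
lemma imagePoints_secantPoly (hk : k ≤ N) :
    {Q : ℙ K (⋀[K]^k V) | ∃ P : Fin s → ℙ K (⋀[K]^k V),
      (∀ i, P i ∈ pluckerGrassmannian K V k) ∧ Q.submodule ≤ ⨆ i, (P i).submodule} =
    imagePoints (secantPoly b s (k := k)) := by
  have hiff : ∀ Q : ℙ K (⋀[K]^k V), Q ∈ imagePoints (secantPoly b s (k := k)) ↔
      ∃ (t : Fin s → K) (v : Fin s → Fin k → V),
        Q.rep = ∑ a, t a • exteriorPower.ιMulti K k (v a) := by
    intro Q
    constructor
    · rintro ⟨x, hx⟩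
      refine ⟨x ∘ Sum.inl, vectorsOf b x, (coords K _).injective ?_⟩
      rw [hx]
      exact funext fun j => eval_secantPoly b j x
    · rintro ⟨t, v, h⟩
      refine ⟨paramOf b t v, ?_⟩
      rw [h]
      funext j
      rw [eval_secantPoly, vectorsOf_paramOf]
      rfl
  ext Q
  rw [hiff]
  constructor
  · rintro ⟨P, hP, hQ⟩
    choose v hv hPv using hP
    have h1 : Q.rep ∈ Submodule.span K (Set.range fun a => exteriorPower.ιMulti K k (v a)) := by
      rw [Submodule.span_range_eq_iSup]
      have h2 : Q.rep ∈ Q.submodule := by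
        rw [Projectivization.submodule_eq]
        exact Submodule.mem_span_singleton_self _
      have h3 := hQ h2
      simp only [hPv] at h3
      exact h3
    obtain ⟨t, ht⟩ := (Submodule.mem_span_range_iff_exists_fun K).1 h1
    exact ⟨t, v, ht.symm⟩
  · rintro ⟨t, v, h⟩
    have hP : ∀ a, ∃ P ∈ pluckerGrassmannian K V k,
        exteriorPower.ιMulti K k (v a) ∈ P.submodule := by
      intro a
      by_cases hv : LinearIndependent K (v a)
      · refine ⟨Projectivization.mk K _ (ιMulti_ne_zero hv),
          ⟨v a, hv, Projectivization.submodule_mk _ _⟩, ?_⟩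
        rw [Projectivization.submodule_mk]
        exact Submodule.mem_span_singleton_self _
      · have hb : LinearIndependent K (b ∘ Fin.castLE hk) :=
          b.linearIndependent.comp _ (Fin.castLE_injective hk)
        refine ⟨Projectivization.mk K _ (ιMulti_ne_zero hb),
          ⟨_, hb, Projectivization.submodule_mk _ _⟩, ?_⟩
        rw [AlternatingMap.map_linearDependent _ _ hv]
        exact zero_mem _
    choose P hP hvP using hP
    refine ⟨P, hP, ?_⟩
    rw [Projectivization.submodule_eq, Submodule.span_singleton_le_iff_mem, h]
    exact Submodule.sum_mem _ fun a _ =>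
      Submodule.smul_mem _ _ (Submodule.mem_iSup_of_mem a (hvP a))

end SecantParametrisation

/-! ### Generic families of vectors -/

section Generic

open MvPolynomial Module

/-- A property which holds where a polynomial in affine linear functions does not vanish holds
generically. -/
lemma generically_of_eval_ne_zero {K : Type*} [Field K] {E : Type*} [AddCommGroup E] [Module K E]
    [FiniteDimensional K E] {σ : Type*} (G : MvPolynomial σ K) (c : σ → K) (φ : σ → Dual K E)
    (h0 : ∃ v, eval (fun i => c i + φ i v) G ≠ 0) {p : E → Prop}
    (hp : ∀ v, eval (fun i => c i + φ i v) G ≠ 0 → p v) : Generically K E p := by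
  set f : MvPolynomial (Fin (finrank K E)) K :=
    aeval (fun i => C (c i) + ∑ j, C (φ i (finBasis K E j)) * X j) G with hf
  have heval : ∀ v, evalAt K E f v = eval (fun i => c i + φ i v) G := by
    intro v
    rw [evalAt_eq, hf, ← coe_aeval_eq_eval, ← coe_aeval_eq_eval]
    change aeval _ (aeval _ G) = aeval _ G
    rw [comp_aeval_apply]
    congr 2
    funext i
    have h1 : φ i v = ∑ j, coords K E v j * φ i (finBasis K E j) := by
      conv_lhs => rw [← (finBasis K E).sum_repr v, map_sum]
      exact Finset.sum_congr rfl fun j _ => by rw [map_smul, smul_eq_mul]; rfl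
    rw [h1]
    simp [mul_comm]
  refine ⟨f, ?_, fun v hv => hp v (by rwa [← heval])⟩
  obtain ⟨v, hv⟩ := h0
  rintro h
  rw [← heval, h, evalAt_eq, map_zero] at hv
  exact hv rfl

end Generic

end GrassmannSecant

end

theorem proposition1p2 (K : Type*) [Field K] [IsAlgClosed K] [CharZero K]
    (V : Type*) [AddCommGroup V] [Module K V] [FiniteDimensional K V]
    (n k s : ℕ) (hV : Module.finrank K V = n + 1) (hk : k ≤ n + 1) (hs : 1 ≤ s) :
    ∃ d : ℕ,
      GrassmannSecant.dim K (⋀[K]^k V)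
        (GrassmannSecant.secantVariety K (⋀[K]^k V)
          (GrassmannSecant.pluckerGrassmannian K V k) s) = d ∧
      GrassmannSecant.Generically K (Fin s → Fin k → V) fun v =>
        (d : ℤ) = (Module.finrank K (GrassmannSecant.perp K k
            (GrassmannSecant.fatPiece K v (n + 1 - k))) : ℤ) - 1 ∧
        (d : ℤ) = (((n + 1).choose k : ℤ)
            - Module.finrank K (GrassmannSecant.fatPiece K v (n + 1 - k))) - 1 ∧
        (d : ℤ) = (((n + 1).choose k : ℤ) - 1)
            - Module.finrank K (GrassmannSecant.fatPiece K v (n + 1 - k)) := by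
  open GrassmannSecant MvPolynomial in
  obtain ⟨m, hm⟩ : ∃ m, n + 1 = m + k := ⟨n + 1 - k, by omega⟩
  let b := Module.finBasisOfFinrankEq K V hV
  let Φ := secantPoly b s (k := k)
  have hb : LinearIndependent K (b ∘ Fin.castLE hk) :=
    b.linearIndependent.comp _ (Fin.castLE_injective hk)
  obtain ⟨j₀, hj₀⟩ : ∃ j, coords K _ (exteriorPower.ιMulti K k (b ∘ Fin.castLE hk)) j ≠ 0 := by
    refine Function.ne_iff.1 fun h => ιMulti_ne_zero hb ?_
    exact (coords K _).map_eq_zero_iff.1 h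
  have hwedge : ∀ a : Fin s, wedgePoly b a j₀ ≠ 0 := by
    intro a h
    have h1 := eval_wedgePoly b a j₀ (paramOf b 0 fun _ => b ∘ Fin.castLE hk)
    rw [vectorsOf_paramOf, h, map_zero] at h1
    exact hj₀ h1.symm
  have hΦ0 : Φ ≠ 0 := by
    intro h
    have h1 := eval_secantPoly b j₀
      (paramOf b (Pi.single (⟨0, hs⟩ : Fin s) 1) fun _ => b ∘ Fin.castLE hk)
    rw [vectorsOf_paramOf, show secantPoly b s j₀ = 0 from congrFun h j₀, map_zero,
      Finset.sum_eq_single ⟨0, hs⟩ (fun a _ ha => by simp [paramOf, ha]) (by simp)] at h1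
    simp only [paramOf, Sum.elim_inl, Pi.single_eq_same, one_smul] at h1
    exact hj₀ h1.symm
  -- The maximal rank of the differential of the parametrisation.
  obtain ⟨x₀, hx₀⟩ : ∃ x₀, ∀ x, Module.finrank K (LinearMap.range (differential Φ x)) ≤
      Module.finrank K (LinearMap.range (differential Φ x₀)) := by
    have hbdd : BddAbove (Set.range fun x =>
        Module.finrank K (LinearMap.range (differential Φ x))) :=
      ⟨_, by rintro _ ⟨x, rfl⟩; exact Submodule.finrank_le _⟩
    obtain ⟨x₀, h⟩ := Nat.sSup_mem (Set.range_nonempty _) hbdd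
    refine ⟨x₀, fun x => ?_⟩
    simp only at h
    rw [h]
    exact le_csSup hbdd ⟨x, rfl⟩
  set r := Module.finrank K (LinearMap.range (differential Φ x₀)) with hr
  obtain ⟨hr1, hdim⟩ := dim_closure_imagePoints (by omega : 1 + k ≠ 0)
    (secantPoly_isHomogeneous b s) hΦ0 hx₀ ⟨x₀, rfl⟩
  refine ⟨r - 1, ?_, ?_⟩
  · rw [← hdim, ← imagePoints_secantPoly b hk]
    rfl
  -- The rank is maximal off the zero set of `g`; the other two factors of `G` make the scalars
  -- nonzero and the families of vectors independent. Freezing the scalars at those of a point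
  -- where `G ≠ 0` leaves a nonzero polynomial in the vectors alone.
  obtain ⟨g, hg0, hg⟩ := exists_rank_le Φ x₀
  have hgne : g ≠ 0 := by rintro rfl; simp at hg0
  set G := g * ((∏ a : Fin s, X (Sum.inl a)) * ∏ a : Fin s, wedgePoly b a j₀) with hG
  have hGne : G ≠ 0 := mul_ne_zero hgne (mul_ne_zero
    (Finset.prod_ne_zero_iff.2 fun a _ => X_ne_zero _)
    (Finset.prod_ne_zero_iff.2 fun a _ => hwedge a))
  obtain ⟨z, hz⟩ := exists_eval_ne_zero hGne
  let c : ParamIndex (n + 1) s k → K := Sum.elim (z ∘ Sum.inl) 0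
  let φ : ParamIndex (n + 1) s k → Module.Dual K (Fin s → Fin k → V) :=
    Sum.elim 0 fun p => (b.coord p.2.2 ∘ₗ LinearMap.proj p.2.1) ∘ₗ LinearMap.proj p.1
  have hparam : ∀ v, (fun i => c i + φ i v) = paramOf b (z ∘ Sum.inl) v := by
    intro v
    funext p
    rcases p with a | p <;> simp [c, φ, paramOf]
  refine generically_of_eval_ne_zero G c φ ⟨vectorsOf b z, ?_⟩ fun v hv => ?_
  · rwa [hparam, paramOf_vectorsOf]
  rw [hparam, hG, map_mul, map_mul, map_prod, map_prod] at hv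
  have ht : ∀ a, paramOf b (z ∘ Sum.inl) v (Sum.inl a) ≠ 0 := fun a => by
    have := Finset.prod_ne_zero_iff.1 (left_ne_zero_of_mul (right_ne_zero_of_mul hv)) a
      (Finset.mem_univ a)
    rwa [eval_X] at this
  have hli : ∀ a, LinearIndependent K (v a) := fun a => by
    have h1 := Finset.prod_ne_zero_iff.1 (right_ne_zero_of_mul (right_ne_zero_of_mul hv)) a
      (Finset.mem_univ a)
    rw [eval_wedgePoly, vectorsOf_paramOf] at h1
    refine linearIndependent_of_ιMulti_ne_zero fun h => h1 ?_
    rw [h, map_zero, Pi.zero_apply]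
  have hrank : Module.finrank K (⨆ a, tangentSpan K (v a) : Submodule K (⋀[K]^k V)) = r := by
    have h1 := range_differential_secantPoly b ht
    rw [vectorsOf_paramOf] at h1
    have h2 := le_antisymm (hx₀ _) (hg _ (left_ne_zero_of_mul hv))
    rw [← LinearEquiv.finrank_map_eq (coords K (⋀[K]^k V)), ← h1]
    exact h2
  obtain ⟨hperp, hfat⟩ := finrank_fatPiece_perp (hV.trans hm) hli
  rw [hrank] at hperp hfat
  rw [show n + 1 - k = m by omega, hperp, hm]
  have h1 : ((r - 1 : ℕ) : ℤ) = r - 1 := by omega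
  refine ⟨?_, ?_, ?_⟩ <;> omega
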